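/- **Conventions.** An *oriented marked graph diagram* is an oriented link diagram in the plane that may also contain 4-valent vertices, each equipped with a marker (a short segment through the vertex separating two pairs of adjacent edges). Every edge is oriented, and going around each marked vertex the four edges point alternately to the vertex and away from it. The same diagrams with ends on the bottom and top of a box (up to plane isotopy fixing the ends) are used for the two sides of a local move. A diagram in a box is written as a word that is read from bottom to top, positions of strands being counted from the left: - $\cup_i$, $\cap_i$: a local minimum, resp. maximum, whose legs are at the positions $i,i+1$; - $\sigma_i$, $\bar\sigma_i$: a crossing of the strands $i,i+1$ in which the strand from south-west to north-east goes over, resp. under; - $h_i$, $v_i$: a marked vertex on the strands $i,i+1$ whose four legs are diagonal and whose marker is horizontal, resp. vertical; - $1$: vertical strands only. The *unoriented Yoshikawa moves* (with the mirror moves) are $$\Omega_1:\ \cup_2\sigma_1\cap_2\leftrightarrow 1,\qquad \Omega_{1a}:\ \cup_2\bar\sigma_1\cap_2\leftrightarrow 1\quad\text{(on one strand)},\qquad \Omega_2:\ \sigma_1\bar\sigma_1\leftrightarrow 1\quad\text{(on two strands)},$$ $$\Omega_3:\ \sigma_1\sigma_2\bar\sigma_1\leftrightarrow\bar\sigma_2\sigma_1\sigma_2,\qquad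 \Omega_{3a}:\ \sigma_1\sigma_2\sigma_1\leftrightarrow\sigma_2\sigma_1\sigma_2,$$ $$\Omega_4:\ \sigma_1\sigma_2h_1\leftrightarrow h_2\sigma_1\sigma_2,\quad \Omega_{4a}:\ \sigma_1\sigma_2v_1\leftrightarrow v_2\sigma_1\sigma_2,\quad \Omega'_4:\ \bar\sigma_1\bar\sigma_2h_1\leftrightarrow h_2\bar\sigma_1\bar\sigma_2,\quad \Omega'_{4a}:\ \bar\sigma_1\bar\sigma_2v_1\leftrightarrow v_2\bar\sigma_1\bar\sigma_2,$$ $$\Omega_5:\ \bar\sigma_1v_1\leftrightarrow v_1\bar\sigma_1,\quad \Omega_{5a}:\ \bar\sigma_1h_1\leftrightarrow h_1\bar\sigma_1,\quad \Omega_{5b}:\ \sigma_1v_1\leftrightarrow v_1\sigma_1,\quad \Omega_{5c}:\ \sigma_1h_1\leftrightarrow h_1\sigma_1,$$ $$\Omega_6:\ \cup_2v_1\cap_2\leftrightarrow 1,\qquad \Omega'_6:\ \cup_2h_1\cap_2\leftrightarrow 1\quad\text{(on one strand)},\qquad \Omega_7:\ v_1h_2\leftrightarrow h_2v_1\quad\text{(on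 three strands)},$$ $$\Omega_8:\ \sigma_2\sigma_1\sigma_3\sigma_2v_1h_3\leftrightarrow\bar\sigma_2\bar\sigma_1\bar\sigma_3\bar\sigma_2v_1h_3,\qquad \Omega_{8a}:\ \sigma_2\sigma_1\sigma_3\sigma_2h_1v_3\leftrightarrow\bar\sigma_2\bar\sigma_1\bar\sigma_3\bar\sigma_2h_1v_3.$$ The *oriented Yoshikawa moves* are these moves with all possible orientations of the strands (agreeing at the ends on both sides). Let $\Gamma_i$, $\Gamma'_i$ be the following oriented moves, given by the orientations of the strands at the bottom of the box, from left to right (which determine the orientation of the whole picture): $\Gamma_1$ is $\Omega_1$ with $\uparrow$; $\Gamma'_1$ is $\Omega_1$ with $\downarrow$; $\Gamma_2$ is $\Omega_2$ with $\uparrow\uparrow$; $\Gamma_3$ is $\Omega_3$ with $\downarrow\uparrow\downarrow$; $\Gamma_4$ and $\Gamma'_4$ are $\Omega_4$ and $\Omega'_4$ with $\uparrow\uparrow\downarrow$; $\Gamma_5$ is $\Omega_5$ with $\uparrow\downarrow$; $\Gamma_6$ and $\Gamma'_6$ are $\Omega_6$ and $\Omega'_6$ with $\uparrow$; $\Gamma_7$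 is $\Omega_7$ with $\uparrow\downarrow\uparrow$; $\Gamma_8$ is $\Omega_8$ with $\uparrow\downarrow\uparrow\downarrow$. A set $S$ of oriented Yoshikawa moves is a *generating set* if, whenever an oriented marked graph diagram $D'$ (closed in the plane, or with ends on the bottom and top of a box) is obtained from $D$ by an oriented Yoshikawa move, $D'$ is also obtained from $D$ by a finite sequence of plane isotopies and moves in $S$, each usable in both directions. **Theorem.** The set $$\mathfrak S_1=\{\Gamma_1,\Gamma'_1,\Gamma_2,\Gamma_3,\Gamma_4,\Gamma'_4,\Gamma_5,\Gamma_6,\Gamma'_6,\Gamma_7,\Gamma_8\}$$ is a generating set of oriented Yoshikawa moves. It contains the move $\Gamma_3$, which is a cyclic $\Omega_3$ move: its central triangle is cyclically oriented (on both sides of the move). -/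

import Mathlib

/-! Oriented marked graph diagrams, plane isotopies and oriented Yoshikawa moves.

Diagrams are plane diagrams in general position with respect to the height function: they are read
from bottom to top and cut by horizontal lines into slices, each of which contains one local
maximum, one local minimum, one crossing or one marked vertex. -/

namespace Yoshikawa

/-- The direction in which an oriented strand crosses a horizontal line. -/
inductive Dir
  | up
  | down
  deriving DecidableEq

/-- The opposite direction. -/
def Dir.flip : Dir → Dir
  | .up => .down
  | .down => .up

/-- The two diagonals at a crossing: `rising` runs from south-west to north-east, `falling` from
north-west to south-east.  As a datum of a crossing it names the over-strand. -/
inductive Slope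
  | rising
  | falling
  deriving DecidableEq

/-- The effect of a quarter turn on the diagonals. -/
def Slope.turn : Slope → Slope
  | .rising => .falling
  | .falling => .rising

/-- The marker of a marked vertex with four diagonal legs is horizontal (it lies in the west and
east regions) or vertical (it lies in the south and north regions). -/
inductive Marker
  | horizontal
  | vertical
  deriving DecidableEq

/-- The effect of a quarter turn on markers. -/
def Marker.turn : Marker → Marker
  | .horizontal => .vertical
  | .vertical => .horizontal

/-- The oriented elementary pieces.
* `cup a` is a local minimum, its left leg has direction `a`, its right leg the opposite direction;
* `cap a` is a local maximum, its left leg has direction `a`, its right leg the opposite direction;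
* `crossing o a b` is a crossing with over-strand `o`, whose rising strand has direction `a` and
  whose falling strand has direction `b`;
* `vertex m a` is a vertex with marker `m`. The south-west and north-west legs have direction `a`,
  the south-east and north-east legs the opposite one, so two opposite legs point to the vertex
  and the other two away from it. -/
inductive Piece
  | cup (a : Dir)
  | cap (a : Dir)
  | crossing (o : Slope) (a b : Dir)
  | vertex (m : Marker) (a : Dir)
  deriving DecidableEq

/-- The directions of the lower legs of a piece, from left to right. -/
def Piece.dom : Piece → List Dir
  | .cup _ => []
  | .cap a => [a, a.flip]
  | .crossing _ a b => [a, b]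
  | .vertex _ a => [a, a.flip]

/-- The directions of the upper legs of a piece, from left to right. -/
def Piece.cod : Piece → List Dir
  | .cup a => [a, a.flip]
  | .cap _ => []
  | .crossing _ a b => [b, a]
  | .vertex _ a => [a, a.flip]

/-- A horizontal slice: one piece, with vertical strands to its left and to its right. -/
structure Slice where
  left : List Dir
  piece : Piece
  right : List Dir
  deriving DecidableEq

/-- The directions of the strands at the bottom of a slice. -/
def Slice.bot (s : Slice) : List Dir := s.left ++ s.piece.dom ++ s.right

/-- The directions of the strands at the top of a slice. -/
def Slice.top (s : Slice) : List Dir := s.left ++ s.piece.cod ++ s.right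

/-- Put further vertical strands to the left and to the right of a slice. -/
def Slice.widen (l r : List Dir) (s : Slice) : Slice := ⟨l ++ s.left, s.piece, s.right ++ r⟩

/-- `Fits u D v`: the slices of `D`, stacked from bottom to top, fit together with matching
orientations and lead from the boundary word `u` to the boundary word `v`. -/
def Fits : List Dir → List Slice → List Dir → Prop
  | u, [], v => u = v
  | u, s :: D, v => s.bot = u ∧ Fits s.top D v

/-- Oriented marked graph diagrams in a horizontal strip, with boundary word `u` at the bottom and
`v` at the top.  `Diagram [] []` is the type of the (closed) oriented marked graph diagrams in
the plane; the other types contain the diagrams of tangles, such as the two sides of a move. -/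
structure Diagram (u v : List Dir) where
  slices : List Slice
  fits : Fits u slices v

/-- A local move: two stacks of slices in a box, with the same ends on the bottom and the top
of the box. -/
structure LocalMove where
  bot : List Dir
  top : List Dir
  lhs : List Slice
  rhs : List Slice
  deriving DecidableEq

/-- Both sides of the move are diagrams with the given boundary. -/
def LocalMove.Valid (M : LocalMove) : Prop :=
  Fits M.bot M.lhs M.top ∧ Fits M.bot M.rhs M.top

/-- `D'` is obtained from `D` by replacing, in some box, the left side of `M` by its right side;
`l` and `r` are the strands to the left and right of the box, `A` and `B` the parts of the
diagram below and above it. -/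
def LocalMove.Rel (M : LocalMove) {u v : List Dir} (D D' : Diagram u v) : Prop :=
  ∃ (l r : List Dir) (A B : List Slice),
    Fits u A (l ++ M.bot ++ r) ∧ Fits (l ++ M.top ++ r) B v ∧
    D.slices = A ++ M.lhs.map (Slice.widen l r) ++ B ∧
    D'.slices = A ++ M.rhs.map (Slice.widen l r) ++ B

/-! ### Plane isotopies -/

/-- The elementary plane isotopies of diagrams that are cut into slices. -/
inductive IsElementaryIsotopy : LocalMove → Prop
  /-- Two pieces lying side by side change their relative height. -/
  | exchange (e f : Piece) (m : List Dir) :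
      IsElementaryIsotopy
        ⟨e.dom ++ m ++ f.dom, e.cod ++ m ++ f.cod,
          [⟨[], e, m ++ f.dom⟩, ⟨e.cod ++ m, f, []⟩],
          [⟨e.dom ++ m, f, []⟩, ⟨[], e, m ++ f.cod⟩]⟩
  /-- A maximum followed by a minimum along a strand is straightened. -/
  | zigzag (a : Dir) :
      IsElementaryIsotopy
        ⟨[a], [a], [⟨[a], .cup a.flip, []⟩, ⟨[], .cap a, [a]⟩], []⟩
  /-- The same for the mirror image. -/
  | zagzig (a : Dir) :
      IsElementaryIsotopy
        ⟨[a], [a], [⟨[], .cup a, [a]⟩, ⟨[a], .cap a.flip, []⟩], []⟩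
  /-- A crossing whose north-west leg is bent down on the left and whose south-east leg is bent up
  on the right is turned counterclockwise by a right angle. -/
  | turnCrossing (o : Slope) (a b : Dir) :
      IsElementaryIsotopy
        ⟨[b.flip, a], [a, b.flip],
          [⟨[b.flip, a], .cup b, []⟩, ⟨[b.flip], .crossing o a b, [b.flip]⟩,
            ⟨[], .cap b.flip, [a, b.flip]⟩],
          [⟨[], .crossing o.turn b.flip a, []⟩]⟩
  /-- The same for a marked vertex. -/
  | turnVertex (m : Marker) (a : Dir) :
      IsElementaryIsotopy
        ⟨[a.flip, a], [a.flip, a],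
          [⟨[a.flip, a], .cup a.flip, []⟩, ⟨[a.flip], .vertex m a, [a]⟩,
            ⟨[], .cap a.flip, [a.flip, a]⟩],
          [⟨[], .vertex m.turn a.flip, []⟩]⟩

/-- Plane isotopy (relative to the boundary). -/
def PlaneIsotopic {u v : List Dir} : Diagram u v → Diagram u v → Prop :=
  Relation.EqvGen fun D D' => ∃ M, IsElementaryIsotopy M ∧ M.Rel D D'

/-- `D'` is obtained from `D` by a finite sequence of plane isotopies and moves in `S`, each move
being used in either direction. -/
def Obtained (S : Set LocalMove) {u v : List Dir} : Diagram u v → Diagram u v → Prop :=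
  Relation.ReflTransGen fun D D' =>
    PlaneIsotopic D D' ∨ ∃ M ∈ S, M.Rel D D' ∨ M.Rel D' D

/-! ### Unoriented Yoshikawa moves -/

/-- The pieces without orientation. -/
inductive UPiece
  | cup
  | cap
  | crossing (o : Slope)
  | vertex (m : Marker)
  deriving DecidableEq

/-- A slice without orientation: a piece with `left` strands to its left and `right` strands to
its right. -/
structure USlice where
  left : ℕ
  piece : UPiece
  right : ℕ
  deriving DecidableEq

/-- The two sides of an unoriented move. -/
structure UMove where
  lhs : List USlice
  rhs : List USlice
  deriving DecidableEq

/-- Forget the orientation of a piece. -/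
def Piece.forget : Piece → UPiece
  | .cup _ => .cup
  | .cap _ => .cap
  | .crossing o _ _ => .crossing o
  | .vertex m _ => .vertex m

/-- Forget the orientation of a slice. -/
def Slice.forget (s : Slice) : USlice := ⟨s.left.length, s.piece.forget, s.right.length⟩

open UPiece Slope Marker in
/-- A kink on the right of a strand; the rising strand is over. -/
def Ω1 : UMove := ⟨[⟨1, cup, 0⟩, ⟨0, crossing rising, 1⟩, ⟨1, cap, 0⟩], []⟩

open UPiece Slope Marker in
/-- A kink on the right of a strand; the falling strand is over. -/
def Ω1a : UMove := ⟨[⟨1, cup, 0⟩, ⟨0, crossing falling, 1⟩, ⟨1, cap, 0⟩], []⟩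

open UPiece Slope Marker in
/-- The left one of two parallel strands passes twice over the right one. -/
def Ω2 : UMove := ⟨[⟨0, crossing rising, 0⟩, ⟨0, crossing falling, 0⟩], []⟩

open UPiece Slope Marker in
/-- A strand running from the left to the right passes over a crossing with falling over-strand. -/
def Ω3 : UMove :=
  ⟨[⟨0, crossing rising, 1⟩, ⟨1, crossing rising, 0⟩, ⟨0, crossing falling, 1⟩],
   [⟨1, crossing falling, 0⟩, ⟨0, crossing rising, 1⟩, ⟨1, crossing rising, 0⟩]⟩

open UPiece Slope Marker in
/-- A strand running from the left to the right passes over a crossing with rising over-strand. -/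
def Ω3a : UMove :=
  ⟨[⟨0, crossing rising, 1⟩, ⟨1, crossing rising, 0⟩, ⟨0, crossing rising, 1⟩],
   [⟨1, crossing rising, 0⟩, ⟨0, crossing rising, 1⟩, ⟨1, crossing rising, 0⟩]⟩

open UPiece Slope Marker in
/-- A strand running from the left to the right passes over a vertex with horizontal marker. -/
def Ω4 : UMove :=
  ⟨[⟨0, crossing rising, 1⟩, ⟨1, crossing rising, 0⟩, ⟨0, vertex horizontal, 1⟩],
   [⟨1, vertex horizontal, 0⟩, ⟨0, crossing rising, 1⟩, ⟨1, crossing rising, 0⟩]⟩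

open UPiece Slope Marker in
/-- A strand running from the left to the right passes over a vertex with vertical marker. -/
def Ω4a : UMove :=
  ⟨[⟨0, crossing rising, 1⟩, ⟨1, crossing rising, 0⟩, ⟨0, vertex vertical, 1⟩],
   [⟨1, vertex vertical, 0⟩, ⟨0, crossing rising, 1⟩, ⟨1, crossing rising, 0⟩]⟩

open UPiece Slope Marker in
/-- A strand running from the left to the right passes under a vertex with horizontal marker. -/
def Ω4' : UMove :=
  ⟨[⟨0, crossing falling, 1⟩, ⟨1, crossing falling, 0⟩, ⟨0, vertex horizontal, 1⟩],
   [⟨1, vertex horizontal, 0⟩, ⟨0, crossing falling, 1⟩, ⟨1, crossing falling, 0⟩]⟩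

open UPiece Slope Marker in
/-- A strand running from the left to the right passes under a vertex with vertical marker. -/
def Ω4a' : UMove :=
  ⟨[⟨0, crossing falling, 1⟩, ⟨1, crossing falling, 0⟩, ⟨0, vertex vertical, 1⟩],
   [⟨1, vertex vertical, 0⟩, ⟨0, crossing falling, 1⟩, ⟨1, crossing falling, 0⟩]⟩

/-! The moves of type 5 are usually drawn from left to right: a crossing to the left of a vertex
becomes a crossing to its right.  Here that picture is turned counterclockwise by a right angle,
which exchanges the two slopes and the two markers. -/

open UPiece Slope Marker in
/-- Drawn from left to right: rising over-strand, horizontal marker. -/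
def Ω5 : UMove :=
  ⟨[⟨0, crossing falling, 0⟩, ⟨0, vertex vertical, 0⟩],
   [⟨0, vertex vertical, 0⟩, ⟨0, crossing falling, 0⟩]⟩

open UPiece Slope Marker in
/-- Drawn from left to right: rising over-strand, vertical marker. -/
def Ω5a : UMove :=
  ⟨[⟨0, crossing falling, 0⟩, ⟨0, vertex horizontal, 0⟩],
   [⟨0, vertex horizontal, 0⟩, ⟨0, crossing falling, 0⟩]⟩

open UPiece Slope Marker in
/-- Drawn from left to right: falling over-strand, horizontal marker. -/
def Ω5b : UMove :=
  ⟨[⟨0, crossing rising, 0⟩, ⟨0, vertex vertical, 0⟩],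
   [⟨0, vertex vertical, 0⟩, ⟨0, crossing rising, 0⟩]⟩

open UPiece Slope Marker in
/-- Drawn from left to right: falling over-strand, vertical marker. -/
def Ω5c : UMove :=
  ⟨[⟨0, crossing rising, 0⟩, ⟨0, vertex horizontal, 0⟩],
   [⟨0, vertex horizontal, 0⟩, ⟨0, crossing rising, 0⟩]⟩

open UPiece Slope Marker in
/-- A vertex with vertical marker whose right legs are joined is removed. -/
def Ω6 : UMove := ⟨[⟨1, cup, 0⟩, ⟨0, vertex vertical, 1⟩, ⟨1, cap, 0⟩], []⟩

open UPiece Slope Marker in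
/-- A vertex with horizontal marker whose right legs are joined is removed. -/
def Ω6' : UMove := ⟨[⟨1, cup, 0⟩, ⟨0, vertex horizontal, 1⟩, ⟨1, cap, 0⟩], []⟩

open UPiece Slope Marker in
/-- A vertex with vertical marker, and a vertex with horizontal marker to the north-east of it,
against the mirror image in a vertical line with the markers exchanged. -/
def Ω7 : UMove :=
  ⟨[⟨0, vertex vertical, 1⟩, ⟨1, vertex horizontal, 0⟩],
   [⟨1, vertex horizontal, 0⟩, ⟨0, vertex vertical, 1⟩]⟩

open UPiece Slope Marker in
/-- The lower legs of a vertex with vertical marker (on the left) and those of a vertex with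
horizontal marker (on the right) cross as two bands; the two bands pass through each other. -/
def Ω8 : UMove :=
  ⟨[⟨1, crossing rising, 1⟩, ⟨0, crossing rising, 2⟩, ⟨2, crossing rising, 0⟩,
    ⟨1, crossing rising, 1⟩, ⟨0, vertex vertical, 2⟩, ⟨2, vertex horizontal, 0⟩],
   [⟨1, crossing falling, 1⟩, ⟨0, crossing falling, 2⟩, ⟨2, crossing falling, 0⟩,
    ⟨1, crossing falling, 1⟩, ⟨0, vertex vertical, 2⟩, ⟨2, vertex horizontal, 0⟩]⟩

open UPiece Slope Marker in
/-- The same with the two markers exchanged. -/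
def Ω8a : UMove :=
  ⟨[⟨1, crossing rising, 1⟩, ⟨0, crossing rising, 2⟩, ⟨2, crossing rising, 0⟩,
    ⟨1, crossing rising, 1⟩, ⟨0, vertex horizontal, 2⟩, ⟨2, vertex vertical, 0⟩],
   [⟨1, crossing falling, 1⟩, ⟨0, crossing falling, 2⟩, ⟨2, crossing falling, 0⟩,
    ⟨1, crossing falling, 1⟩, ⟨0, vertex horizontal, 2⟩, ⟨2, vertex vertical, 0⟩]⟩

/-- The unoriented Yoshikawa moves, including the mirror moves. -/
def unorientedYoshikawaMoves : Set UMove :=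
  {Ω1, Ω1a, Ω2, Ω3, Ω3a, Ω4, Ω4a, Ω4', Ω4a', Ω5, Ω5a, Ω5b, Ω5c, Ω6, Ω6', Ω7, Ω8, Ω8a}

/-! ### Oriented Yoshikawa moves -/

/-- `M` is the unoriented move `N` with some orientation of its strands. -/
def IsOrientationOf (M : LocalMove) (N : UMove) : Prop :=
  M.Valid ∧ M.lhs.map Slice.forget = N.lhs ∧ M.rhs.map Slice.forget = N.rhs

/-- The oriented Yoshikawa moves: the unoriented ones with all possible orientations. -/
def orientedYoshikawaMoves : Set LocalMove :=
  {M | ∃ N ∈ unorientedYoshikawaMoves, IsOrientationOf M N}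

open Dir Piece Slope Marker in
/-- `Ω1`, oriented upwards. -/
def Γ1 : LocalMove :=
  ⟨[up], [up],
   [⟨[up], cup up, []⟩, ⟨[], crossing rising up up, [down]⟩, ⟨[up], cap up, []⟩],
   []⟩

open Dir Piece Slope Marker in
/-- `Ω1`, oriented downwards. -/
def Γ1' : LocalMove :=
  ⟨[down], [down],
   [⟨[down], cup down, []⟩, ⟨[], crossing rising down down, [up]⟩, ⟨[down], cap down, []⟩],
   []⟩

open Dir Piece Slope Marker in
/-- `Ω2`, both strands oriented upwards. -/
def Γ2 : LocalMove :=
  ⟨[up, up], [up, up],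
   [⟨[], crossing rising up up, []⟩, ⟨[], crossing falling up up, []⟩],
   []⟩

open Dir Piece Slope Marker in
/-- `Ω3`; the top strand is oriented from right to left, the rising strand upwards and the falling
strand downwards. -/
def Γ3 : LocalMove :=
  ⟨[down, up, down], [down, up, down],
   [⟨[], crossing rising down up, [down]⟩, ⟨[up], crossing rising down down, []⟩,
    ⟨[], crossing falling up down, [down]⟩],
   [⟨[down], crossing falling up down, []⟩, ⟨[], crossing rising down down, [up]⟩,
    ⟨[down], crossing rising down up, []⟩]⟩

open Dir Piece Slope Marker in
/-- `Ω4`; the top strand is oriented from left to right, the south-west and north-east legs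
point to the vertex. -/
def Γ4 : LocalMove :=
  ⟨[up, up, down], [up, down, up],
   [⟨[], crossing rising up up, [down]⟩, ⟨[up], crossing rising up down, []⟩,
    ⟨[], vertex horizontal up, [up]⟩],
   [⟨[up], vertex horizontal up, []⟩, ⟨[], crossing rising up up, [down]⟩,
    ⟨[up], crossing rising up down, []⟩]⟩

open Dir Piece Slope Marker in
/-- `Ω4'`; the bottom strand is oriented from left to right, the south-west and north-east legs
point to the vertex. -/
def Γ4' : LocalMove :=
  ⟨[up, up, down], [up, down, up],
   [⟨[], crossing falling up up, [down]⟩, ⟨[up], crossing falling up down, []⟩,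
    ⟨[], vertex horizontal up, [up]⟩],
   [⟨[up], vertex horizontal up, []⟩, ⟨[], crossing falling up up, [down]⟩,
    ⟨[up], crossing falling up down, []⟩]⟩

open Dir Piece Slope Marker in
/-- `Ω5`; drawn from left to right, the strands enter in the north-west and in the north-east. -/
def Γ5 : LocalMove :=
  ⟨[up, down], [down, up],
   [⟨[], crossing falling up down, []⟩, ⟨[], vertex vertical down, []⟩],
   [⟨[], vertex vertical up, []⟩, ⟨[], crossing falling up down, []⟩]⟩

open Dir Piece Slope Marker in
/-- `Ω6`, oriented upwards. -/
def Γ6 : LocalMove :=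
  ⟨[up], [up],
   [⟨[up], cup down, []⟩, ⟨[], vertex vertical up, [up]⟩, ⟨[up], cap down, []⟩],
   []⟩

open Dir Piece Slope Marker in
/-- `Ω6'`, oriented upwards. -/
def Γ6' : LocalMove :=
  ⟨[up], [up],
   [⟨[up], cup down, []⟩, ⟨[], vertex horizontal up, [up]⟩, ⟨[up], cap down, []⟩],
   []⟩

open Dir Piece Slope Marker in
/-- `Ω7`; the ends are oriented up, down, up. -/
def Γ7 : LocalMove :=
  ⟨[up, down, up], [up, down, up],
   [⟨[], vertex vertical up, [up]⟩, ⟨[up], vertex horizontal down, []⟩],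
   [⟨[up], vertex horizontal down, []⟩, ⟨[], vertex vertical up, [up]⟩]⟩

open Dir Piece Slope Marker in
/-- `Ω8`; at both vertices the south-west and north-east legs point to the vertex. -/
def Γ8 : LocalMove :=
  ⟨[up, down, up, down], [up, down, up, down],
   [⟨[up], crossing rising down up, [down]⟩, ⟨[], crossing rising up up, [down, down]⟩,
    ⟨[up, up], crossing rising down down, []⟩, ⟨[up], crossing rising up down, [down]⟩,
    ⟨[], vertex vertical up, [up, down]⟩, ⟨[up, down], vertex horizontal up, []⟩],
   [⟨[up], crossing falling down up, [down]⟩, ⟨[], crossing falling up up, [down, down]⟩,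
    ⟨[up, up], crossing falling down down, []⟩, ⟨[up], crossing falling up down, [down]⟩,
    ⟨[], vertex vertical up, [up, down]⟩, ⟨[up, down], vertex horizontal up, []⟩]⟩

/-- The set of the eleven moves above. -/
def S1 : Set LocalMove := {Γ1, Γ1', Γ2, Γ3, Γ4, Γ4', Γ5, Γ6, Γ6', Γ7, Γ8}

/-- A generating set: a set of oriented Yoshikawa moves such that every oriented Yoshikawa move,
wherever it is applied, is obtained by a finite sequence of plane isotopies and moves in the
set.  As `u`, `v` are arbitrary, this covers the moves on closed diagrams in the plane as well as
the passage from one side of a move to the other inside the box of the move. -/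
def IsGeneratingSet (S : Set LocalMove) : Prop :=
  S ⊆ orientedYoshikawaMoves ∧
  ∀ M ∈ orientedYoshikawaMoves, ∀ (u v : List Dir) (D D' : Diagram u v),
    M.Rel D D' → Obtained S D D'

/-! ### Cyclic moves of type 3 -/

/-- The initial corner of a side with lower corner `p`, upper corner `q` and direction `a`. -/
def sideStart (a : Dir) (p q : Fin 3) : Fin 3 :=
  match a with
  | .up => p
  | .down => q

/-- A triangle with corners `0`, `1`, `2` (in the order of increasing height), whose side between
`i` and `j` has direction `aij`, is cyclically oriented if every corner is the initial point of
exactly one side. -/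
def CyclicTriangle (a01 a02 a12 : Dir) : Prop :=
  Function.Bijective ![sideStart a01 0 1, sideStart a02 0 2, sideStart a12 1 2]

/-- `M` is an oriented `Ω3` move whose central triangle, before and after the move, is cyclically
oriented.  The corners of the triangle are the three crossings.  On the left side of the move the
long side is the leftmost strand above the two lower crossings, on the right side it is the
rightmost one; the short sides are the middle strands above the two lower crossings. -/
def IsCyclicΩ3 (M : LocalMove) : Prop :=
  IsOrientationOf M Ω3 ∧
  (∃ (X Y Z : Slice) (a01 a02 a12 b c : Dir), M.lhs = [X, Y, Z] ∧
    X.top = [a02, a01, b] ∧ Y.top = [a02, a12, c] ∧ CyclicTriangle a01 a02 a12) ∧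
  (∃ (X Y Z : Slice) (a01 a02 a12 b c : Dir), M.rhs = [X, Y, Z] ∧
    X.top = [b, a01, a02] ∧ Y.top = [c, a12, a02] ∧ CyclicTriangle a01 a02 a12)

end Yoshikawa

namespace Yoshikawa

/-! ### Fitting stacks of slices -/

/-! A move is `Derivable` if every application of it can be replaced by isotopies and moves of the
set. This property is closed under inversion, composition and insertion into a larger diagram. So it
suffices to pass from one side of each oriented move to the other inside its own box, by a finite
list of rewriting steps; `derivable_of_derives` turns an evaluation of such a list into
derivability.

Reidemeister moves: a `Γ1` kink is pushed across an antiparallel strand with the cyclic `Γ3`, and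
the bigon left over is parallel, so `Γ2` removes it. This gives all antiparallel `Ω2` moves
(`derivable_bigon_of_kink`), then the other kinks and a second type of `Ω3`; the same trick with
these gives the remaining parallel `Ω2`. Once all bigons are available, rotating an `Ω3` move and
carrying a crossing to the other side of the equation reach every `Ω3`.

Vertices: rotations of the box and bigons spread `Γ5` to all flypes of vertices with vertical
marker, and `Γ4`, `Γ4'` to all passes of a strand over or under a vertex (`derivable_pass`). Passes
and kinks show that a vertex with all four legs bent upwards may be turned by a right angle at the
cost of one leg crossing the other three. This carries flypes from one marker to the other
(`derivable_flype_turn`). With all passes and flypes at hand, `Γ6`, `Γ6'`, `Γ7`, `Γ8` yield their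
variants by half turns, by conjugation with twists, and by exchanging the two vertices of `Ω8`.
Finally, an orientation of an unoriented move is determined by finitely many directions, and fitting
leaves just the families derived before. -/

instance Fits.decidable : ∀ u D v, Decidable (Fits u D v)
  | u, [], v => inferInstanceAs (Decidable (u = v))
  | u, s :: D, v =>
    have := Fits.decidable s.top D v
    inferInstanceAs (Decidable (s.bot = u ∧ Fits s.top D v))

instance (M : LocalMove) : Decidable M.Valid :=
  inferInstanceAs (Decidable (Fits M.bot M.lhs M.top ∧ Fits M.bot M.rhs M.top))

/-- The boundary word above a stack of slices that starts at `u`. -/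
def finalWord : List Dir → List Slice → List Dir
  | u, [] => u
  | _, s :: D => finalWord s.top D

theorem Fits.eq_finalWord {u v : List Dir} {D : List Slice} (h : Fits u D v) :
    v = finalWord u D := by
  induction D generalizing u with
  | nil => exact h.symm
  | cons s D ih => exact ih h.2

theorem fits_append {u v : List Dir} {D E : List Slice} :
    Fits u (D ++ E) v ↔ ∃ w, Fits u D w ∧ Fits w E v := by
  induction D generalizing u with
  | nil => simp [Fits]
  | cons s D ih => simp [Fits, ih, and_assoc]

theorem Fits.append {u v w : List Dir} {D E : List Slice} (hD : Fits u D w) (hE : Fits w E v) :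
    Fits u (D ++ E) v :=
  fits_append.2 ⟨w, hD, hE⟩

theorem Fits.widen {u v : List Dir} {D : List Slice} (h : Fits u D v) (l r : List Dir) :
    Fits (l ++ u ++ r) (D.map (Slice.widen l r)) (l ++ v ++ r) := by
  induction D generalizing u with
  | nil => cases h; rfl
  | cons s D ih =>
    refine ⟨?_, ?_⟩
    · simp [← h.1, Slice.bot, Slice.widen]
    · have := ih h.2
      simpa [Slice.top, Slice.widen] using this

theorem Slice.widen_widen (l l' r r' : List Dir) (s : Slice) :
    (s.widen l' r').widen l r = s.widen (l ++ l') (r' ++ r) := by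
  simp [Slice.widen]

/-! ### Moves that follow from a set of moves -/

/-- The inverse of a move. -/
def LocalMove.symm (M : LocalMove) : LocalMove := ⟨M.bot, M.top, M.rhs, M.lhs⟩

/-- `M` can be replaced, wherever it is applied, by plane isotopies and moves in `S`. -/
def Derivable (S : Set LocalMove) (M : LocalMove) : Prop :=
  M.Valid ∧ ∀ (u v : List Dir) (D D' : Diagram u v), M.Rel D D' → Obtained S D D'

variable {S : Set LocalMove}

theorem Obtained.symm {u v : List Dir} {D D' : Diagram u v} (h : Obtained S D D') :
    Obtained S D' D := by
  induction h with
  | refl => exact .refl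
  | tail _ h ih =>
    refine .head ?_ ih
    rcases h with h | ⟨M, hM, h⟩
    · exact .inl (.symm _ _ h)
    · exact .inr ⟨M, hM, h.symm⟩

theorem LocalMove.Rel.symm {M : LocalMove} {u v : List Dir} {D D' : Diagram u v}
    (h : M.Rel D D') : M.symm.Rel D' D := by
  obtain ⟨l, r, A, B, hA, hB, h, h'⟩ := h
  exact ⟨l, r, A, B, hA, hB, h', h⟩

theorem Derivable.symm {M : LocalMove} (h : Derivable S M) : Derivable S M.symm :=
  ⟨⟨h.1.2, h.1.1⟩, fun _ _ _ _ hD => (h.2 _ _ _ _ hD.symm).symm⟩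

theorem Derivable.of_mem {M : LocalMove} (hM : M ∈ S) (hv : M.Valid) : Derivable S M :=
  ⟨hv, fun _ _ _ _ h => .single (.inr ⟨M, hM, .inl h⟩)⟩

theorem Derivable.of_isotopy {M : LocalMove} (hM : IsElementaryIsotopy M) (hv : M.Valid) :
    Derivable S M :=
  ⟨hv, fun _ _ _ _ h => .single (.inl (.rel _ _ ⟨M, hM, h⟩))⟩

theorem Derivable.refl {u v : List Dir} {D : List Slice} (h : Fits u D v) :
    Derivable S ⟨u, v, D, D⟩ := by
  refine ⟨⟨h, h⟩, ?_⟩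
  rintro _ _ ⟨A, hA⟩ ⟨B, hB⟩ ⟨l, r, P, Q, -, -, h, h'⟩
  obtain rfl : A = B := h.trans h'.symm
  exact .refl

theorem Derivable.trans {u v : List Dir} {D E F : List Slice} (h : Derivable S ⟨u, v, D, E⟩)
    (h' : Derivable S ⟨u, v, E, F⟩) : Derivable S ⟨u, v, D, F⟩ := by
  refine ⟨⟨h.1.1, h'.1.2⟩, ?_⟩
  rintro _ _ A B ⟨l, r, P, Q, hP, hQ, hA, hB⟩
  -- The intermediate diagram exists because the middle stack fits; this is why `Derivable` includes
  -- validity.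
  let C : Diagram _ _ := ⟨_, (hP.append (h.1.2.widen l r)).append hQ⟩
  exact (h.2 _ _ A C ⟨l, r, P, Q, hP, hQ, hA, rfl⟩).trans
    (h'.2 _ _ C B ⟨l, r, P, Q, hP, hQ, rfl, hB⟩)

/-- A context inside a context is again a context: the side strands and the outer slices of the two
boxes are merged. -/
theorem Derivable.within {M : LocalMove} (h : Derivable S M) {u v l r : List Dir}
    {P Q : List Slice} (hP : Fits u P (l ++ M.bot ++ r)) (hQ : Fits (l ++ M.top ++ r) Q v) :
    Derivable S ⟨u, v, P ++ M.lhs.map (Slice.widen l r) ++ Q,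
      P ++ M.rhs.map (Slice.widen l r) ++ Q⟩ := by
  refine ⟨⟨(hP.append (h.1.1.widen l r)).append hQ, (hP.append (h.1.2.widen l r)).append hQ⟩, ?_⟩
  rintro _ _ A B ⟨l', r', P', Q', hP', hQ', hA, hB⟩
  refine h.2 _ _ A B ⟨l' ++ l, r ++ r', P' ++ P.map (Slice.widen l' r'),
    Q.map (Slice.widen l' r') ++ Q', ?_, ?_, ?_, ?_⟩
  · simpa using hP'.append (hP.widen l' r')
  · simpa using (hQ.widen l' r').append hQ'
  · simp [hA, Slice.widen_widen, Function.comp_def]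
  · simp [hB, Slice.widen_widen, Function.comp_def]

/-! ### Derivations as sequences of rewriting steps -/

/-- Apply the move `M` to the slices of `D` from number `p` on, with `k` strands to the left of the
box of the move. -/
def rewriteAt (u : List Dir) (D : List Slice) (p k : ℕ) (M : LocalMove) : Option (List Slice) :=
  let w := finalWord u (D.take p)
  let l := w.take k
  let r := w.drop (k + M.bot.length)
  if w = l ++ M.bot ++ r ∧
      D = D.take p ++ M.lhs.map (Slice.widen l r) ++ D.drop (p + M.lhs.length) then
    some (D.take p ++ M.rhs.map (Slice.widen l r) ++ D.drop (p + M.lhs.length))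
  else none

theorem derivable_rewriteAt {u v : List Dir} {D E : List Slice} {p k : ℕ} {M : LocalMove}
    (hM : Derivable S M) (hD : Fits u D v) (h : rewriteAt u D p k M = some E) :
    Derivable S ⟨u, v, D, E⟩ := by
  unfold rewriteAt at h
  simp only [Option.ite_none_right_eq_some, Option.some.injEq] at h
  obtain ⟨⟨hw, hl⟩, rfl⟩ := h
  generalize D.take p = P at *
  generalize D.drop (p + M.lhs.length) = Q at *
  generalize List.take k (finalWord u P) = l at *
  generalize List.drop (k + M.bot.length) (finalWord u P) = r at *
  subst hl
  obtain ⟨w', hPM, hQ⟩ := fits_append.1 hD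
  obtain ⟨w, hP, hM'⟩ := fits_append.1 hPM
  obtain rfl := hP.eq_finalWord
  -- The bottom word and the slices of a stack determine its top word, so the word above the matched
  -- block must be the widened top of the move.
  have := hM'.eq_finalWord
  rw [hw, ← (hM.1.1.widen l r).eq_finalWord] at this
  subst this
  exact hM.within (hw ▸ hP) hQ

/-- The exchange of the heights of two pieces, as a move. -/
def exchangeMove (e f : Piece) (m : List Dir) : LocalMove :=
  ⟨e.dom ++ m ++ f.dom, e.cod ++ m ++ f.cod,
    [⟨[], e, m ++ f.dom⟩, ⟨e.cod ++ m, f, []⟩], [⟨e.dom ++ m, f, []⟩, ⟨[], e, m ++ f.cod⟩]⟩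

theorem derivable_exchangeMove (e f : Piece) (m : List Dir) :
    Derivable S (exchangeMove e f m) :=
  .of_isotopy (.exchange e f m) (by
    simp [LocalMove.Valid, exchangeMove, Fits, Slice.bot, Slice.top])

/-- Exchange the slices number `p` and `p + 1`, if their pieces lie side by side. -/
def exchangeAt (u : List Dir) (D : List Slice) (p : ℕ) : Option (List Slice) :=
  match D.drop p with
  | s :: t :: _ =>
    -- Either the lower piece lies on the left, or the upper one does and the exchange is read
    -- backwards. Dropping the strands up to and including the legs of the left piece leaves the
    -- strands between the two pieces.
    (rewriteAt u D p s.left.length (exchangeMove s.piece t.piece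
      (t.left.drop (s.left.length + s.piece.cod.length)))).or
    (rewriteAt u D p t.left.length (exchangeMove t.piece s.piece
      (s.left.drop (t.left.length + t.piece.dom.length))).symm)
  | _ => none

theorem derivable_exchangeAt {u v : List Dir} {D E : List Slice} {p : ℕ}
    (hD : Fits u D v) (h : exchangeAt u D p = some E) : Derivable S ⟨u, v, D, E⟩ := by
  unfold exchangeAt at h
  split at h
  · rw [Option.or_eq_some_iff] at h
    rcases h with h | ⟨-, h⟩
    · exact derivable_rewriteAt (derivable_exchangeMove _ _ _) hD h
    · exact derivable_rewriteAt (derivable_exchangeMove _ _ _).symm hD h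
  · cases h

/-- A step of a derivation: the exchange of two consecutive slices from number `p` on, or an
application, from left to right or from right to left, of the first suitable move in the `n`-th of
several lists of moves, to the slices from number `p` on, with `k` strands on the left. -/
inductive Step
  | exch (p : ℕ)
  | fwd (n p k : ℕ)
  | bwd (n p k : ℕ)

/-- Carry out a step. -/
def Step.run (F : List (List LocalMove)) (u : List Dir) (D : List Slice) :
    Step → Option (List Slice)
  | .exch p => exchangeAt u D p
  | .fwd n p k => (F.getD n []).findSome? (rewriteAt u D p k)
  | .bwd n p k => (F.getD n []).findSome? fun M => rewriteAt u D p k M.symm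

/-- Carry out several steps. -/
def runSteps (F : List (List LocalMove)) (u : List Dir) : List Slice → List Step →
    Option (List Slice)
  | D, [] => some D
  | D, s :: t => (s.run F u D).bind fun E => runSteps F u E t

/-- All moves in a list are derivable. -/
def AllDerivable (S : Set LocalMove) (L : List LocalMove) : Prop := ∀ M ∈ L, Derivable S M

theorem AllDerivable.single {M : LocalMove} (h : Derivable S M) : AllDerivable S [M] := by
  simpa [AllDerivable] using h

theorem AllDerivable.append {L L' : List LocalMove} (h : AllDerivable S L)
    (h' : AllDerivable S L') : AllDerivable S (L ++ L') := fun M hM =>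
  (List.mem_append.1 hM).elim (h M) (h' M)

/-- All moves in several lists are derivable. -/
inductive Available (S : Set LocalMove) : List (List LocalMove) → Prop
  | nil : Available S []
  | cons {L : List LocalMove} {F : List (List LocalMove)} :
      AllDerivable S L → Available S F → Available S (L :: F)

theorem Available.getD {F : List (List LocalMove)} (hF : Available S F) (n : ℕ) :
    AllDerivable S (F.getD n []) := by
  induction hF generalizing n with
  | nil => intro M hM; cases hM
  | cons hL _ ih =>
    cases n with
    | zero => exact hL
    | succ n => exact ih n

theorem derivable_run {F : List (List LocalMove)} (hF : Available S F)
    {u v : List Dir} {D E : List Slice} (hD : Fits u D v) {s : Step}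
    (h : s.run F u D = some E) : Derivable S ⟨u, v, D, E⟩ := by
  cases s with
  | exch p => exact derivable_exchangeAt hD h
  | fwd n p k =>
    obtain ⟨M, hM, h⟩ := List.exists_of_findSome?_eq_some h
    exact derivable_rewriteAt (hF.getD n M hM) hD h
  | bwd n p k =>
    obtain ⟨M, hM, h⟩ := List.exists_of_findSome?_eq_some h
    exact derivable_rewriteAt (hF.getD n M hM).symm hD h

theorem derivable_runSteps {F : List (List LocalMove)} (hF : Available S F)
    {u v : List Dir} {D E : List Slice} (hD : Fits u D v) {t : List Step}
    (h : runSteps F u D t = some E) : Derivable S ⟨u, v, D, E⟩ := by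
  induction t generalizing D with
  | nil => cases h; exact .refl hD
  | cons s t ih =>
    obtain ⟨D', hs, ht⟩ := Option.bind_eq_some_iff.1 h
    have hs' := derivable_run hF hD hs
    exact hs'.trans (ih hs'.1.2 ht)

/-- The steps `t`, which use the lists of moves `F`, lead from the left to the right side of `M`. -/
def derives (F : List (List LocalMove)) (t : List Step) (M : LocalMove) : Bool :=
  decide (Fits M.bot M.lhs M.top) && decide (runSteps F M.bot M.lhs t = some M.rhs)

theorem derivable_of_derives (F : List (List LocalMove)) (t : List Step) {M : LocalMove}
    (hF : Available S F) (h : derives F t M = true) : Derivable S M := by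
  simp only [derives, Bool.and_eq_true, decide_eq_true_eq] at h
  exact derivable_runSteps hF h.1 h.2

/-! ### Words -/

/-- A letter stands for a slice with a given number of strands on the left of its piece.  The
number of strands on the right, and the orientation of all pieces except minima, are determined
by the boundary word below the slice. -/
inductive Letter
  | cup (k : ℕ) (a : Dir)
  | cap (k : ℕ)
  | crossing (o : Slope) (k : ℕ)
  | vertex (m : Marker) (k : ℕ)

/-- The slice that a letter denotes above a given boundary word. -/
def Letter.slice (w : List Dir) : Letter → Slice
  | .cup k a => ⟨w.take k, .cup a, w.drop k⟩
  -- The default `.up` here and below is reached only if there are too few strands, in which case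
  -- the resulting slice does not fit on `w`.
  | .cap k => ⟨w.take k, .cap (w.getD k .up), w.drop (k + 2)⟩
  | .crossing o k => ⟨w.take k, .crossing o (w.getD k .up) (w.getD (k + 1) .up), w.drop (k + 2)⟩
  | .vertex m k => ⟨w.take k, .vertex m (w.getD k .up), w.drop (k + 2)⟩

/-- The stack of slices that a word denotes above a given boundary word. -/
def stack : List Dir → List Letter → List Slice
  | _, [] => []
  | w, c :: t => c.slice w :: stack (c.slice w).top t

/-- The letter that denotes a slice. -/
def Slice.letter (s : Slice) : Letter :=
  match s.piece with
  | .cup a => .cup s.left.length a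
  | .cap _ => .cap s.left.length
  | .crossing o _ _ => .crossing o s.left.length
  | .vertex m _ => .vertex m s.left.length

theorem Slice.slice_letter (s : Slice) : s.letter.slice s.bot = s := by
  obtain ⟨l, p, r⟩ := s
  cases p <;> simp [Slice.letter, Letter.slice, Slice.bot, Piece.dom]

theorem Fits.stack_eq {u v : List Dir} {D : List Slice} (h : Fits u D v) :
    stack u (D.map Slice.letter) = D := by
  induction D generalizing u with
  | nil => rfl
  | cons s D ih =>
    obtain ⟨rfl, h⟩ := h
    simp [stack, Slice.slice_letter, ih h]

/-- The move with bottom word `u` whose sides are given by two words. -/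
def wordMove (u : List Dir) (s t : List Letter) : LocalMove :=
  ⟨u, finalWord u (stack u s), stack u s, stack u t⟩

/-! ### Lists of moves -/

/-- The moves `f a` for all directions `a`. -/
def overDirs (f : Dir → LocalMove) : List LocalMove := [f .up, f .down]

/-- The moves `f a b` for all directions `a`, `b`. -/
def overDirPairs (f : Dir → Dir → LocalMove) : List LocalMove :=
  overDirs (f .up) ++ overDirs (f .down)

/-- The union of the lists `f o` for all slopes `o`. -/
def overSlopes (f : Slope → List LocalMove) : List LocalMove := f .rising ++ f .falling

/-- The union of the lists `f m` for all markers `m`. -/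
def overMarkers (f : Marker → List LocalMove) : List LocalMove := f .vertical ++ f .horizontal

theorem AllDerivable.overDirs {f : Dir → LocalMove} (h : ∀ a, Derivable S (f a)) :
    AllDerivable S (overDirs f) := by
  simp [AllDerivable, Yoshikawa.overDirs, h]

theorem AllDerivable.overDirPairs {f : Dir → Dir → LocalMove} (h : ∀ a b, Derivable S (f a b)) :
    AllDerivable S (overDirPairs f) :=
  (AllDerivable.overDirs (h _)).append (.overDirs (h _))

theorem AllDerivable.overSlopes {f : Slope → List LocalMove} (h : ∀ o, AllDerivable S (f o)) :
    AllDerivable S (overSlopes f) :=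
  (h _).append (h _)

theorem AllDerivable.overMarkers {f : Marker → List LocalMove} (h : ∀ m, AllDerivable S (f m)) :
    AllDerivable S (overMarkers f) :=
  (h _).append (h _)

/-! ### Sliding crossings and vertices along maxima and minima -/

/-- A maximum followed by a minimum along a strand is straightened. -/
def zigzag (a : Dir) : LocalMove := wordMove [a] [.cup 1 a.flip, .cap 0] []

/-- The mirror image of `zigzag`. -/
def zagzig (a : Dir) : LocalMove := wordMove [a] [.cup 0 a, .cap 1] []

/-- A crossing is turned counterclockwise by a right angle. -/
def crossingTurn (o : Slope) (a b : Dir) : LocalMove :=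
  wordMove [b.flip, a] [.cup 2 b, .crossing o 1, .cap 0] [.crossing o.turn 0]

/-- A vertex is turned counterclockwise by a right angle. -/
def vertexTurn (m : Marker) (a : Dir) : LocalMove :=
  wordMove [a.flip, a] [.cup 2 a.flip, .vertex m 1, .cap 0] [.vertex m.turn 0]

/-- A crossing slides along a maximum. -/
def crossingCap (o : Slope) (a b : Dir) : LocalMove :=
  wordMove [b.flip, a, b] [.crossing o 1, .cap 0] [.crossing o.turn 0, .cap 1]

/-- A crossing slides along a minimum. -/
def crossingCup (o : Slope) (a b : Dir) : LocalMove :=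
  wordMove [a] [.cup 1 b, .crossing o 0] [.cup 0 b, .crossing o.turn 1]

/-- A vertex slides along a maximum. -/
def vertexCap (m : Marker) (a : Dir) : LocalMove :=
  wordMove [a.flip, a, a.flip] [.vertex m 1, .cap 0] [.vertex m.turn 0, .cap 1]

/-- A vertex slides along a minimum. -/
def vertexCup (m : Marker) (a : Dir) : LocalMove :=
  wordMove [a] [.cup 1 a.flip, .vertex m 0] [.cup 0 a, .vertex m.turn 1]

theorem derivable_zigzag (a : Dir) : Derivable S (zigzag a) := by
  -- The two forms of this move differ by `a.flip.flip` in place of `a`, which reduces only for a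
  -- concrete direction.
  have h := IsElementaryIsotopy.zigzag a
  cases a <;> exact .of_isotopy h (by decide +kernel)

theorem derivable_zagzig (a : Dir) : Derivable S (zagzig a) :=
  .of_isotopy (.zagzig a) (by cases a <;> decide +kernel)

theorem derivable_crossingTurn (o : Slope) (a b : Dir) : Derivable S (crossingTurn o a b) :=
  .of_isotopy (.turnCrossing o a b) (by cases o <;> cases a <;> cases b <;> decide +kernel)

theorem derivable_vertexTurn (m : Marker) (a : Dir) : Derivable S (vertexTurn m a) := by
  have h := IsElementaryIsotopy.turnVertex m a
  cases a <;> exact .of_isotopy h (by cases m <;> decide +kernel)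

theorem available_turns {L : List LocalMove} (hL : AllDerivable S L) :
    Available S [overDirs zigzag, overDirs zagzig, L] :=
  .cons (.overDirs derivable_zigzag) <| .cons (.overDirs derivable_zagzig) <| .cons hL .nil

/-- A minimum and a maximum are created on the south-east leg. With this minimum the elementary turn
applies, and the new maximum is what remains. -/
theorem derivable_crossingCap (o : Slope) (a b : Dir) : Derivable S (crossingCap o a b) :=
  derivable_of_derives _ [.bwd 1 0 2, .exch 1, .exch 2, .fwd 2 0 0]
    (available_turns (.single (derivable_crossingTurn o a b)))
    (by cases o <;> cases a <;> cases b <;> decide +kernel)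

theorem derivable_crossingCup (o : Slope) (a b : Dir) : Derivable S (crossingCup o a b) :=
  derivable_of_derives _ [.bwd 1 2 0, .exch 1, .exch 0, .fwd 2 1 1]
    (available_turns (.single (derivable_crossingTurn o a b)))
    (by cases o <;> cases a <;> cases b <;> decide +kernel)

theorem derivable_vertexCap (m : Marker) (a : Dir) : Derivable S (vertexCap m a) :=
  derivable_of_derives _ [.bwd 1 0 2, .exch 1, .exch 2, .fwd 2 0 0]
    (available_turns (.single (derivable_vertexTurn m a)))
    (by cases m <;> cases a <;> decide +kernel)

theorem derivable_vertexCup (m : Marker) (a : Dir) : Derivable S (vertexCup m a) :=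
  derivable_of_derives _ [.bwd 1 2 0, .exch 1, .exch 0, .fwd 2 1 1]
    (available_turns (.single (derivable_vertexTurn m a)))
    (by cases m <;> cases a <;> decide +kernel)

/-- The plane isotopies that are used in derivations, besides exchanges. -/
def isotopies : List (List LocalMove) :=
  [overDirs zigzag, overDirs zagzig,
    overSlopes (fun o => overDirPairs (crossingCap o)) ++
      overSlopes (fun o => overDirPairs (crossingCup o)),
    overMarkers (fun m => overDirs (vertexCap m)) ++ overMarkers (fun m => overDirs (vertexCup m))]

theorem Available.isotopies_append {F : List (List LocalMove)} (hF : Available S F) :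
    Available S (isotopies ++ F) :=
  .cons (.overDirs derivable_zigzag) <|
  .cons (.overDirs derivable_zagzig) <|
  .cons (.append (.overSlopes fun _ => .overDirPairs (derivable_crossingCap _))
    (.overSlopes fun _ => .overDirPairs (derivable_crossingCup _))) <|
  .cons (.append (.overMarkers fun _ => .overDirs (derivable_vertexCap _))
    (.overMarkers fun _ => .overDirs (derivable_vertexCup _))) hF

/-- The steps `t`, which use plane isotopies and the lists of moves `F`, lead from the left to the
right side of `M`. -/
theorem derivable_of_steps {M : LocalMove} {F : List (List LocalMove)} (t : List Step)
    (hF : Available S F) (h : derives (isotopies ++ F) t M = true) : Derivable S M :=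
  derivable_of_derives _ t hF.isotopies_append h

/-! ### Reidemeister moves -/

/-- A bigon is removed: the left one of two strands passes twice over the right one if `o` is
rising, and twice under it otherwise. -/
def bigon (o : Slope) (a b : Dir) : LocalMove :=
  wordMove [a, b] [.crossing o 0, .crossing o.turn 0] []

/-- A kink on the right of a strand is removed. -/
def kink (o : Slope) (a : Dir) : LocalMove :=
  wordMove [a] [.cup 1 a, .crossing o 0, .cap 1] []

/-- A move of type `Ω3`, with arbitrary crossings. -/
def triangle (x y z : Slope) (a b c : Dir) : LocalMove :=
  wordMove [a, b, c] [.crossing x 0, .crossing y 1, .crossing z 0]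
    [.crossing z 1, .crossing y 0, .crossing x 1]

/-- The box is rotated by a half turn: slopes are preserved, but the two crossings are met in the
opposite order, and the ends are reversed in order and direction. -/
theorem Derivable.bigon_rotate {o : Slope} {a b : Dir} (h : Derivable S (bigon o a b)) :
    Derivable S (bigon o.turn b.flip a.flip) :=
  derivable_of_steps
    [.bwd 0 2 1, .exch 1, .bwd 2 2 0, .bwd 0 3 2, .exch 2, .bwd 2 3 1, .exch 0, .exch 1, .exch 2,
    .bwd 2 3 0, .exch 4, .bwd 2 3 1, .fwd 4 2 2, .exch 1, .fwd 0 0 1, .fwd 0 0 0]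
    (.cons (.single h) .nil) (by cases o <;> cases a <;> cases b <;> decide +kernel)

/-- A kink on one strand is pushed across the other strand. -/
theorem derivable_bigon_of_kink {x y : Slope} {a b : Dir} (hk : Derivable S (kink y a))
    (ht : Derivable S (triangle x y x.turn a b a)) (hb : Derivable S (bigon x a.flip b)) :
    Derivable S (bigon x a b) :=
  derivable_of_steps
    [.bwd 4 1 1, .exch 3, .exch 0, .fwd 5 1 0, .fwd 2 0 1, .bwd 2 3 1, .exch 1, .fwd 6 2 2, .fwd 4
    0 0]
    (.cons (.single hk) <| .cons (.single ht) <| .cons (.single hb) .nil)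
    (by cases x <;> cases y <;> cases a <;> cases b <;> decide +kernel)

/-- The given kink is created on the right leg of the minimum. After both crossings have been slid
along the bends they form a bigon; its removal leaves a zigzag. -/
theorem Derivable.kink_flip {o : Slope} {a : Dir} (hk : Derivable S (kink o a.flip))
    (hb : Derivable S (bigon o.turn a.flip a)) : Derivable S (kink o.turn a) :=
  derivable_of_steps
    [.bwd 2 1 0, .bwd 4 1 2, .exch 0, .bwd 2 2 2, .exch 1, .fwd 1 2 1, .fwd 5 1 1, .fwd 0 0 0]
    (.cons (.single hk) <| .cons (.single hb) .nil) (by cases o <;> cases a <;> decide +kernel)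

/-- The six ends are rotated by one place: the last strand becomes the first one and is reversed,
its two crossings change slope, and the two sides of the move are interchanged. -/
theorem Derivable.triangle_rotate {x y z : Slope} {a b c : Dir}
    (h : Derivable S (triangle x y z a b c)) :
    Derivable S (triangle y.turn z.turn x c.flip a b) :=
  derivable_of_steps
    [.bwd 0 2 2, .exch 1, .bwd 2 2 1, .exch 0, .exch 1, .bwd 2 2 0, .exch 3, .bwd 4 1 1, .exch 0,
    .fwd 2 3 0, .exch 2, .exch 1, .fwd 2 3 1, .exch 2, .fwd 0 3 2]
    (.cons (.single h) .nil)
    (by cases x <;> cases y <;> cases z <;> cases a <;> cases b <;> cases c <;> decide +kernel)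

/-- The lower left crossing is moved to the other side of the equation. -/
theorem Derivable.triangle_left {x y z : Slope} {a b c : Dir}
    (h : Derivable S (triangle x y z a b c)) (hb : Derivable S (bigon x a b))
    (hb' : Derivable S (bigon x.turn b a)) : Derivable S (triangle x.turn z y b a c) :=
  derivable_of_steps [.bwd 5 3 1, .bwd 4 1 0, .fwd 5 0 0]
    (.cons (.single h) <| .cons (.append (.single hb) (.single hb')) .nil)
    (by cases x <;> cases y <;> cases z <;> cases a <;> cases b <;> cases c <;> decide +kernel)

/-- The lower right crossing is moved to the other side of the equation. -/
theorem Derivable.triangle_right {x y z : Slope} {a b c : Dir}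
    (h : Derivable S (triangle x y z a b c)) (hb : Derivable S (bigon z b c))
    (hb' : Derivable S (bigon z.turn c b)) : Derivable S (triangle y x z.turn a c b) :=
  derivable_of_steps [.bwd 5 0 1, .bwd 4 1 0, .fwd 5 3 0]
    (.cons (.single h) <| .cons (.append (.single hb') (.single hb)) .nil)
    (by cases x <;> cases y <;> cases z <;> cases a <;> cases b <;> cases c <;> decide +kernel)

/-! ### All oriented Reidemeister moves from `Γ1`, `Γ1'`, `Γ2`, `Γ3` -/

theorem derivable_of_mem_S1 {M : LocalMove} (hM : M ∈ S1) : Derivable S1 M := by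
  refine .of_mem hM ?_
  simp only [S1, Set.mem_insert_iff, Set.mem_singleton_iff] at hM
  rcases hM with rfl | rfl | rfl | rfl | rfl | rfl | rfl | rfl | rfl | rfl | rfl <;> decide +kernel

theorem derivable_kink_rising (a : Dir) : Derivable S1 (kink .rising a) := by
  have h : Derivable S1 Γ1 := derivable_of_mem_S1 (by simp [S1])
  have h' : Derivable S1 Γ1' := derivable_of_mem_S1 (by simp [S1])
  cases a
  exacts [h, h']

theorem derivable_bigon_rising_up : Derivable S1 (bigon .rising .up .up) :=
  derivable_of_mem_S1 (M := Γ2) (by simp [S1])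

theorem derivable_triangle_cyclic :
    Derivable S1 (triangle .rising .rising .falling .down .up .down) :=
  derivable_of_mem_S1 (M := Γ3) (by simp [S1])

/-- When a kink on one strand is pushed across an antiparallel one, the three strands of the
triangle alternate in direction, as in `Γ3` and its rotations, and the bigon that remains is a
parallel one obtained from `Γ2`. -/
theorem derivable_bigon_antiparallel (o : Slope) (a : Dir) :
    Derivable S1 (bigon o a a.flip) := by
  have h₂ := derivable_bigon_rising_up
  have h₃ := derivable_triangle_cyclic
  have hud : Derivable S1 (bigon .falling .up .down) :=
    derivable_bigon_of_kink (derivable_kink_rising .up) h₃.triangle_rotate h₂.bigon_rotate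
  have hdu : Derivable S1 (bigon .rising .down .up) :=
    derivable_bigon_of_kink (derivable_kink_rising .down) h₃ h₂
  cases o <;> cases a
  · exact hud.bigon_rotate
  · exact hdu
  · exact hud
  · exact hdu.bigon_rotate

theorem derivable_kink (o : Slope) (a : Dir) :
    Derivable S1 (kink o a) := by
  cases o
  · exact derivable_kink_rising a
  · have hb := derivable_bigon_antiparallel .falling a.flip
    refine (derivable_kink_rising a.flip).kink_flip ?_
    cases a <;> exact hb

theorem derivable_bigon (o : Slope) (a b : Dir) :
    Derivable S1 (bigon o a b) := by
  have h₂ := derivable_bigon_rising_up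
  have h₃ := derivable_triangle_cyclic
  have hb := derivable_bigon_antiparallel
  -- The second use of the kink trick, now for parallel strands, needs a triangle with all strands
  -- upwards. Carrying a crossing across uses antiparallel bigons only, and four rotations then
  -- adjust the directions.
  have h₃' : Derivable S1 (triangle .falling .falling .rising .up .up .up) :=
    (h₃.triangle_right (hb _ .up) (hb _ .down)).triangle_rotate.triangle_rotate
      |>.triangle_rotate.triangle_rotate
  have huu : Derivable S1 (bigon .falling .up .up) :=
    derivable_bigon_of_kink (derivable_kink .falling .up) h₃' (hb _ .down)
  cases a <;> cases b
  · cases o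
    exacts [h₂, huu]
  · exact hb o .up
  · exact hb o .down
  · cases o
    exacts [huu.bigon_rotate, h₂.bigon_rotate]

theorem derivable_triangle_rising (a b c : Dir) :
    Derivable S1 (triangle .rising .rising .rising a b c) := by
  -- One, two or three rotations reverse the last one, two or three strands, and carrying crossings
  -- across makes all slopes rising again where necessary. These three reversals generate all eight
  -- orientations from a single one.
  have hr : ∀ {a b c}, Derivable S1 (triangle .rising .rising .rising a b c) →
      Derivable S1 (triangle .rising .rising .rising a b c.flip) := fun h =>
    (h.triangle_rotate.triangle_left (derivable_bigon _ _ _) (derivable_bigon _ _ _)).triangle_right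
      (derivable_bigon _ _ _) (derivable_bigon _ _ _)
  have hm : ∀ {a b c}, Derivable S1 (triangle .rising .rising .rising a b c) →
      Derivable S1 (triangle .rising .rising .rising a b.flip c.flip) := fun h =>
    (h.triangle_rotate.triangle_rotate.triangle_right (derivable_bigon _ _ _)
      (derivable_bigon _ _ _)).triangle_left (derivable_bigon _ _ _) (derivable_bigon _ _ _)
  have hl : ∀ {a b c}, Derivable S1 (triangle .rising .rising .rising a b c) →
      Derivable S1 (triangle .rising .rising .rising a.flip b.flip c.flip) := fun h =>
    h.triangle_rotate.triangle_rotate.triangle_rotate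
  have h : Derivable S1 (triangle .rising .rising .rising .down .down .up) :=
    derivable_triangle_cyclic.triangle_right (derivable_bigon _ _ _) (derivable_bigon _ _ _)
  have hu : ∀ b c, Derivable S1 (triangle .rising .rising .rising .down b c) := by
    rintro (_ | _) (_ | _)
    exacts [hr (hm h), hm h, h, hr h]
  cases a
  · have hu' : ∀ b c, Derivable S1 (triangle .rising .rising .rising .up b c) := by
      have := hl (hu .down .down)
      rintro (_ | _) (_ | _)
      exacts [this, hr this, hm (hr this), hm this]
    exact hu' b c
  · exact hu b c

/-- The crossings of a move of type `Ω3` are consistent with an order of its three strands. -/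
theorem derivable_triangle {x y z : Slope} (h : x = z → y = x) (a b c : Dir) :
    Derivable S1 (triangle x y z a b c) := by
  have hb := derivable_bigon
  -- Carrying one lower crossing at a time to the other side connects all six slope patterns that
  -- come from an order of the strands.
  have h₁ : ∀ a b c, Derivable S1 (triangle .falling .rising .rising a b c) := fun a b c =>
    (derivable_triangle_rising b a c).triangle_left (hb _ _ _) (hb _ _ _)
  have h₂ : ∀ a b c, Derivable S1 (triangle .rising .rising .falling a b c) := fun a b c =>
    (derivable_triangle_rising a c b).triangle_right (hb _ _ _) (hb _ _ _)
  have h₃ : ∀ a b c, Derivable S1 (triangle .rising .falling .falling a b c) := fun a b c =>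
    (h₁ a c b).triangle_right (hb _ _ _) (hb _ _ _)
  have h₄ : ∀ a b c, Derivable S1 (triangle .falling .falling .rising a b c) := fun a b c =>
    (h₂ b a c).triangle_left (hb _ _ _) (hb _ _ _)
  have h₅ : ∀ a b c, Derivable S1 (triangle .falling .falling .falling a b c) := fun a b c =>
    (h₃ b a c).triangle_left (hb _ _ _) (hb _ _ _)
  cases x <;> cases y <;> cases z <;> first | exact absurd (h rfl) (by decide) | skip
  exacts [derivable_triangle_rising a b c, h₂ a b c, h₃ a b c, h₁ a b c, h₄ a b c, h₅ a b c]

/-- The moves `bigon o`. -/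
def bigons (o : Slope) : List LocalMove := overDirPairs (bigon o)

/-- The moves `triangle`. -/
def triangles : List LocalMove :=
  overSlopes fun x => overSlopes fun y => overSlopes fun z =>
    if x = z → y = x then overDirs (triangle x y z .up .up) ++ overDirs (triangle x y z .up .down) ++
      overDirs (triangle x y z .down .up) ++ overDirs (triangle x y z .down .down) else []

theorem allDerivable_bigons (o : Slope) : AllDerivable S1 (bigons o) :=
  .overDirPairs (derivable_bigon o)

theorem allDerivable_triangles : AllDerivable S1 triangles := by
  refine .overSlopes fun x => .overSlopes fun y => .overSlopes fun z => ?_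
  split_ifs with h
  · exact ((AllDerivable.overDirs (derivable_triangle h _ _)).append
      (.overDirs (derivable_triangle h _ _))).append
      (.overDirs (derivable_triangle h _ _)) |>.append (.overDirs (derivable_triangle h _ _))
  · intro M hM
    cases hM

/-- A move that removes a kink and changes the direction of a minimum. -/
def cupTwist (o : Slope) (a : Dir) : LocalMove :=
  wordMove [] [.cup 0 a, .crossing o 0] [.cup 0 a.flip]

/-- A move that removes a kink and changes the direction of a maximum. -/
def capTwist (o : Slope) (a : Dir) : LocalMove :=
  wordMove [a, a.flip] [.crossing o 0, .cap 0] [.cap 0]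

/-- A kink on the left of a strand is removed. -/
def leftKink (o : Slope) (a : Dir) : LocalMove :=
  wordMove [a] [.cup 0 a.flip, .crossing o 1, .cap 0] []

theorem derivable_cupTwist (o : Slope) (a : Dir) : Derivable S1 (cupTwist o a) :=
  derivable_of_steps [.bwd 1 2 0, .exch 1, .fwd 2 2 1, .exch 0, .fwd 4 1 1]
    (.cons (.single (derivable_kink o.turn a)) .nil)
    (by cases o <;> cases a <;> decide +kernel)

theorem derivable_capTwist (o : Slope) (a : Dir) : Derivable S1 (capTwist o a) :=
  derivable_of_steps [.bwd 0 1 1, .exch 0, .bwd 2 1 0, .exch 2, .fwd 4 0 1]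
    (.cons (.single (derivable_kink o.turn a.flip)) .nil)
    (by cases o <;> cases a <;> decide +kernel)

theorem derivable_leftKink (o : Slope) (a : Dir) : Derivable S1 (leftKink o a) :=
  derivable_of_steps [.fwd 2 1 0, .fwd 4 0 0, .fwd 1 0 0]
    (.cons (.single (derivable_cupTwist o.turn a.flip)) .nil)
    (by cases o <;> cases a <;> decide +kernel)

/-! ### Strands passing a vertex, and rotating a vertex about the vertical axis -/

/-- A strand that runs from the left to the right passes over a vertex if `o` is rising, and under
it otherwise. -/
def pass (o : Slope) (m : Marker) (c a : Dir) : LocalMove :=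
  wordMove [c, a, a.flip] [.crossing o 0, .crossing o 1, .vertex m 0]
    [.vertex m 1, .crossing o 0, .crossing o 1]

/-- The same for a strand that runs from the right to the left. -/
def passBack (o : Slope) (m : Marker) (c a : Dir) : LocalMove :=
  wordMove [a, a.flip, c] [.crossing o.turn 1, .crossing o.turn 0, .vertex m 1]
    [.vertex m 0, .crossing o.turn 1, .crossing o.turn 0]

/-- A crossing below a vertex is moved to the other side of the vertex. -/
def flype (o : Slope) (m : Marker) (a : Dir) : LocalMove :=
  wordMove [a, a.flip] [.crossing o 0, .vertex m 0] [.vertex m 0, .crossing o 0]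

/-- A half turn interchanges the two sides of the move and preserves the vertex with its directions;
only the passing strand is reversed. -/
theorem Derivable.pass_rotate {o : Slope} {m : Marker} {c a : Dir}
    (h : Derivable S (pass o m c a)) : Derivable S (pass o m c.flip a) :=
  derivable_of_steps
    [.bwd 0 0 0, .exch 1, .exch 2, .exch 3, .bwd 0 4 3, .exch 3, .bwd 3 4 2, .bwd 2 0 1, .exch 1,
    .exch 2, .exch 3, .bwd 0 4 4, .exch 3, .bwd 3 4 3, .bwd 2 0 2, .bwd 2 6 1, .exch 1, .exch 2,
    .exch 3, .bwd 2 4 2, .exch 5, .bwd 4 3 3, .exch 2, .fwd 2 1 3, .fwd 2 3 4, .exch 4, .exch 5,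
    .exch 6, .fwd 2 7 0, .fwd 3 4 2, .exch 3, .exch 2, .fwd 0 4 3, .exch 3, .exch 4, .fwd 2 5 1,
    .fwd 3 2 1, .exch 1, .exch 0, .fwd 0 2 2, .exch 1, .exch 2, .fwd 0 3 2]
    (.cons (.single h) .nil)
    (by cases o <;> cases m <;> cases c <;> cases a <;> decide +kernel)

/-- A quarter turn of the vertex makes the strand separate another pair of adjacent legs. A bigon
created above the vertex at the start and one removed below it at the end compensate for this. -/
theorem Derivable.pass_turn {o : Slope} {m : Marker} {c a : Dir}
    (h : Derivable S1 (pass o m c a)) : Derivable S1 (pass o m.turn c a.flip) :=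
  derivable_of_steps
    [.bwd 6 3 1, .bwd 0 3 1, .exch 2, .bwd 3 3 0, .exch 4, .exch 3, .bwd 2 2 2, .exch 1, .fwd 4 2
    1, .exch 4, .fwd 2 3 0, .exch 2, .exch 1, .fwd 3 3 1, .exch 2, .fwd 0 3 2, .fwd 5 0 0]
    (.cons (.single h) <| .cons (allDerivable_bigons o) <| .cons (allDerivable_bigons o.turn) .nil)
    (by cases o <;> cases m <;> cases c <;> cases a <;> decide +kernel)

theorem Derivable.passBack {o : Slope} {m : Marker} {c a : Dir}
    (h : Derivable S1 (pass o m c a)) : Derivable S1 (passBack o m c a) :=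
  derivable_of_steps [.bwd 5 3 0, .bwd 5 4 1, .bwd 4 2 0, .fwd 6 1 0, .fwd 6 0 1]
    (.cons (.single h) <| .cons (allDerivable_bigons o) <| .cons (allDerivable_bigons o.turn) .nil)
    (by cases o <;> cases m <;> cases c <;> cases a <;> decide +kernel)

/-- The moves `flype` for vertices with marker `m`. -/
def flypes (m : Marker) : List LocalMove := overSlopes fun o => overDirs (flype o m)

/-- A bigon is created below the vertex and a flype moves one of its crossings above. The vertex in
between sees its legs exchanged, so the given move applies there, and triangle moves carry the
passing strand across the two crossings. -/
theorem Derivable.pass_flype {o : Slope} {m : Marker} {c a : Dir}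
    (h : Derivable S1 (pass o m c a)) (hm : AllDerivable S1 (flypes m)) :
    Derivable S1 (pass o m c a.flip) :=
  derivable_of_steps
    [.bwd 7 2 0, .fwd 6 3 0, .fwd 5 0 0, .fwd 4 1 0, .fwd 5 2 0, .fwd 6 0 1, .fwd 7 1 1]
    (.cons (.single h) <| .cons allDerivable_triangles <| .cons hm <|
      .cons (allDerivable_bigons .rising) <| .cons (allDerivable_bigons .falling) .nil)
    (by cases o <;> cases m <;> cases c <;> cases a <;> decide +kernel)

/-- A half turn of the box interchanges the two sides and reverses the directions at the bottom. -/
theorem Derivable.flype_rotate {o : Slope} {m : Marker} {a : Dir}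
    (h : Derivable S (flype o m a)) : Derivable S (flype o m a.flip) :=
  derivable_of_steps
    [.bwd 0 2 1, .exch 1, .bwd 3 2 0, .bwd 0 3 2, .exch 2, .bwd 3 3 1, .exch 0, .exch 1, .exch 2,
    .bwd 2 3 0, .exch 4, .bwd 2 3 1, .bwd 4 2 2, .fwd 2 1 2, .exch 0, .fwd 2 1 3, .exch 2, .exch
      3, .exch 4, .fwd 3 2 1, .exch 1, .fwd 0 2 2, .fwd 3 1 0, .exch 0, .fwd 0 1 1]
    (.cons (.single h) .nil) (by cases o <;> cases m <;> cases a <;> decide +kernel)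

/-- Both sides are composed with the inverse crossing at the bottom and at the top. -/
theorem Derivable.flype_inv {o : Slope} {m : Marker} {a : Dir}
    (h : Derivable S1 (flype o m a)) : Derivable S1 (flype o.turn m a.flip) :=
  derivable_of_steps [.bwd 5 2 0, .bwd 4 1 0, .fwd 6 0 0]
    (.cons (.single h) <| .cons (allDerivable_bigons o) <| .cons (allDerivable_bigons o.turn) .nil)
    (by cases o <;> cases m <;> cases a <;> decide +kernel)

theorem allDerivable_flypes_vertical : AllDerivable S1 (flypes .vertical) := by
  have h : Derivable S1 (flype .falling .vertical .up) :=
    derivable_of_mem_S1 (M := Γ5) (by simp [S1])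
  refine .overSlopes fun o => .overDirs fun a => ?_
  cases o <;> cases a
  exacts [h.flype_inv.flype_rotate, h.flype_inv, h, h.flype_rotate]

theorem derivable_pass (o : Slope) (m : Marker) (c a : Dir) : Derivable S1 (pass o m c a) := by
  have h : Derivable S1 (pass o .horizontal .up .up) := by
    have h₄ : Derivable S1 Γ4 := derivable_of_mem_S1 (by simp [S1])
    have h₄' : Derivable S1 Γ4' := derivable_of_mem_S1 (by simp [S1])
    cases o
    exacts [h₄, h₄']
  have hc : Derivable S1 (pass o .horizontal c .up) := by
    cases c
    exacts [h, h.pass_rotate]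
  have hv := allDerivable_flypes_vertical
  cases m <;> cases a
  -- A quarter turn changes marker and direction together; separating them takes a flype. Only
  -- flypes with vertical marker are known here, so the remaining horizontal case makes a detour
  -- through the vertical marker.
  exacts [hc, (hc.pass_turn.pass_flype hv).pass_turn, hc.pass_turn.pass_flype hv, hc.pass_turn]

/-- The moves `pass`. -/
def passes : List LocalMove := overSlopes fun o => overMarkers fun m => overDirPairs (pass o m)

/-- The moves `passBack`. -/
def passesBack : List LocalMove :=
  overSlopes fun o => overMarkers fun m => overDirPairs (passBack o m)

theorem allDerivable_passes : AllDerivable S1 passes :=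
  .overSlopes fun _ => .overMarkers fun _ => .overDirPairs (derivable_pass _ _)

theorem allDerivable_passesBack : AllDerivable S1 passesBack :=
  .overSlopes fun _ => .overMarkers fun _ => .overDirPairs fun _ _ =>
    (derivable_pass _ _ _ _).passBack

/-! ### Rotating a vertex about the horizontal axis -/

/-- A vertex whose lower legs are bent upwards on its left. -/
def bouquet (m : Marker) (a : Dir) : List Letter := [.cup 0 a, .cup 1 a.flip, .vertex m 2]

/-- The first leg of a bouquet passes the other three. -/
def spiralRight (o : Slope) (m : Marker) (a : Dir) : LocalMove :=
  wordMove [] (bouquet m a ++ [.crossing o 0, .crossing o 1, .crossing o 2])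
    (bouquet m.turn a.flip)

/-- The last leg of a bouquet passes the other three. -/
def spiralLeft (o : Slope) (m : Marker) (a : Dir) : LocalMove :=
  wordMove [] (bouquet m a ++ [.crossing o 2, .crossing o 1, .crossing o 0])
    (bouquet m.turn a.flip)

/-- The move `flype` for a bouquet. -/
def bouquetFlype (m : Marker) (o : Slope) (a : Dir) : LocalMove :=
  wordMove [] (bouquet m a ++ [.crossing o 2]) (bouquet m a.flip ++ [.crossing o 0])

/-- A kink on the moving leg supplies a fourth crossing. Once its arc has been swept across the
vertex, the four crossings cancel in two bigons, and the vertex has been turned by a right angle. -/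
theorem derivable_spiralRight (o : Slope) (m : Marker) (a : Dir) :
    Derivable S1 (spiralRight o m a) :=
  derivable_of_steps
    [.bwd 4 3 0, .exch 5, .exch 6, .exch 7, .exch 2, .exch 1, .exch 0, .exch 3, .exch 4, .bwd 5 5
    3, .exch 2, .fwd 2 3 2, .fwd 7 4 3, .exch 3, .fwd 2 1 1, .fwd 7 2 2, .exch 3, .exch 2, .fwd 0
    1 0, .exch 0, .fwd 3 1 1]
    (.cons (.overDirs (derivable_leftKink o)) <| .cons allDerivable_passes <|
      .cons (allDerivable_bigons o) <| .cons (allDerivable_bigons o.turn) .nil)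
    (by cases o <;> cases m <;> cases a <;> decide +kernel)

theorem derivable_spiralLeft (o : Slope) (m : Marker) (a : Dir) :
    Derivable S1 (spiralLeft o m a) :=
  derivable_of_steps
    [.bwd 4 3 3, .exch 5, .exch 6, .exch 7, .exch 2, .exch 1, .exch 0, .bwd 5 3 2, .exch 2, .exch
      5, .exch 6, .bwd 2 1 0, .bwd 2 3 1, .exch 2, .fwd 7 4 1, .fwd 7 3 0, .bwd 3 3 3, .exch 2, .fwd
    1 3 2]
    (.cons (.overDirs (derivable_kink o)) <| .cons allDerivable_passesBack <|
      .cons (allDerivable_bigons o) <| .cons (allDerivable_bigons o.turn) .nil)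
    (by cases o <;> cases m <;> cases a <;> decide +kernel)

theorem derivable_bouquetFlype {m : Marker} (hm : AllDerivable S (flypes m)) (o : Slope) (a : Dir) :
    Derivable S (bouquetFlype m o a) :=
  derivable_of_steps [.bwd 4 2 2, .bwd 2 1 1, .exch 0, .bwd 2 1 0, .exch 2]
    (.cons hm .nil) (by cases o <;> cases m <;> cases a <;> decide +kernel)

/-- With the legs bent upwards, the crossing lies on the first two legs of a bouquet. Turning the
bouquet to the other marker creates a left spiral whose last crossing cancels it. The known flype
carries the first crossing of the spiral from the last pair of legs to the first pair. A bigon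
completes the two crossings to a right spiral, which turns the bouquet back and leaves one crossing
on the last two legs. -/
theorem derivable_flype_turn {m : Marker} (hm : AllDerivable S1 (flypes m)) (o : Slope) (a : Dir) :
    Derivable S1 (flype o m.turn a) :=
  derivable_of_steps
    [.bwd 0 1 1, .exch 0, .bwd 2 1 0, .bwd 0 2 2, .exch 1, .bwd 2 2 1, .exch 4, .exch 3, .exch 2,
    .bwd 5 0 2, .fwd 8 5 2, .fwd 6 0 2, .bwd 8 5 4, .fwd 4 0 2, .exch 3, .exch 2, .exch 1, .exch
      4, .exch 3, .fwd 0 2 0, .fwd 0 0 1]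
    (.cons (.overMarkers fun n => .overDirs (derivable_spiralRight o.turn n)) <|
      .cons (.overMarkers fun n => .overDirs (derivable_spiralLeft o.turn n)) <|
      .cons (.overSlopes fun o => .overDirs (derivable_bouquetFlype hm o)) <|
      .cons (allDerivable_bigons o) <| .cons (allDerivable_bigons o.turn) .nil)
    (by cases o <;> cases m <;> cases a <;> decide +kernel)

theorem allDerivable_flypes (m : Marker) : AllDerivable S1 (flypes m) := by
  cases m
  · exact .overSlopes fun o => .overDirs (derivable_flype_turn allDerivable_flypes_vertical o)
  · exact allDerivable_flypes_vertical

theorem derivable_flype (o : Slope) (m : Marker) (a : Dir) : Derivable S1 (flype o m a) := by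
  cases m
  · exact derivable_flype_turn allDerivable_flypes_vertical o a
  · exact derivable_flype_turn (allDerivable_flypes .horizontal) o a

/-! ### Moves that remove or exchange vertices -/

/-- A vertex whose right legs are joined is removed. -/
def loop (m : Marker) (a : Dir) : LocalMove :=
  wordMove [a] [.cup 1 a.flip, .vertex m 0, .cap 1] []

/-- A vertex whose left legs are joined is removed. -/
def leftLoop (m : Marker) (a : Dir) : LocalMove :=
  wordMove [a] [.cup 0 a, .vertex m 1, .cap 0] []

/-- The box is rotated by a half turn. -/
theorem Derivable.leftLoop {m : Marker} {a : Dir} (h : Derivable S (loop m a.flip)) :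
    Derivable S (leftLoop m a) :=
  derivable_of_steps
    [.bwd 3 0 0, .bwd 0 2 1, .exch 1, .bwd 3 2 0, .exch 3, .fwd 4 1 1, .fwd 0 0 0]
    (.cons (.single h) .nil) (by cases m <;> cases a <;> decide +kernel)

/-- A flype flips the vertex about the vertical axis, and the arc joining two of its legs then
passes under the vertex to the left. The crossings left over at the minimum and the maximum of this
arc untwist. -/
theorem Derivable.loop_of_leftLoop {m : Marker} {a : Dir}
    (h : Derivable S1 (Yoshikawa.leftLoop m a)) :
    Derivable S1 (loop m a) :=
  derivable_of_steps
    [.bwd 9 1 0, .fwd 5 2 0, .fwd 2 0 0, .bwd 2 3 0, .bwd 9 1 0, .fwd 6 2 0, .fwd 10 4 1, .fwd 8 3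
    0, .fwd 7 0 0, .fwd 4 0 0]
    (.cons (.single h) <| .cons (allDerivable_flypes m) <| .cons allDerivable_passes <|
      .cons (.overSlopes fun o => .overDirs (derivable_cupTwist o)) <|
      .cons (.overSlopes fun o => .overDirs (derivable_capTwist o)) <|
      .cons (allDerivable_bigons .rising) <| .cons (allDerivable_bigons .falling) .nil)
    (by cases m <;> cases a <;> decide +kernel)

theorem derivable_loop (m : Marker) (a : Dir) : Derivable S1 (loop m a) := by
  have h : Derivable S1 (loop m .up) := by
    have h₆ : Derivable S1 Γ6 := derivable_of_mem_S1 (by simp [S1])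
    have h₆' : Derivable S1 Γ6' := derivable_of_mem_S1 (by simp [S1])
    cases m
    exacts [h₆', h₆]
  cases a
  exacts [h, h.leftLoop.loop_of_leftLoop]

/-- Two neighbouring vertices with different markers change their relative height. -/
def neighbours (m : Marker) (a : Dir) : LocalMove :=
  wordMove [a, a.flip, a] [.vertex m 0, .vertex m.turn 1] [.vertex m.turn 1, .vertex m 0]

/-- A half turn of the box exchanges the positions of the two vertices, hence the roles of the
markers. -/
theorem Derivable.neighbours_rotate {a : Dir} (h : Derivable S (neighbours .vertical a.flip)) :
    Derivable S (neighbours .horizontal a) :=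
  derivable_of_steps
    [.bwd 0 2 2, .exch 1, .bwd 3 2 1, .exch 0, .exch 1, .bwd 3 2 0, .bwd 0 3 2, .exch 2, .bwd 3 3
    1, .bwd 0 2 3, .exch 1, .bwd 3 2 2, .exch 3, .exch 4, .exch 2, .fwd 4 3 3, .fwd 3 4 2, .exch
      3, .exch 2, .exch 1, .fwd 3 4 3, .exch 3, .fwd 0 4 4, .exch 3, .exch 2, .fwd 3 4 0, .exch 3,
    .fwd 0 4 1, .fwd 3 1 1, .exch 0, .fwd 0 1 2]
    (.cons (.single h) .nil) (by cases a <;> decide +kernel)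

/-- The move is conjugated by a half twist of three strands. -/
theorem Derivable.neighbours_turn {a : Dir} (h : Derivable S1 (neighbours .horizontal a)) :
    Derivable S1 (neighbours .vertical a) :=
  derivable_of_steps
    -- Three bigons create a half twist and its inverse below the vertices. The inverse is slid
    -- upwards by flypes, passes and a triangle move, which exchanges the positions of the vertices;
    -- afterwards it is slid back.
    [.bwd 9 0 0, .bwd 9 1 1, .bwd 9 2 0, .fwd 5 5 0, .fwd 6 3 0, .fwd 8 4 0, .fwd 5 6 1, .fwd 7 4
    0, .bwd 4 3 0, .bwd 5 4 1, .bwd 6 5 0, .bwd 7 3 0, .bwd 5 5 1, .bwd 8 3 0, .fwd 9 2 0, .fwd 9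
    1 1, .fwd 9 0 0]
    (.cons (.single h) <| .cons (.overMarkers allDerivable_flypes) <| .cons allDerivable_passes <|
      .cons allDerivable_passesBack <| .cons allDerivable_triangles <|
      .cons (allDerivable_bigons .rising) <| .cons (allDerivable_bigons .falling) .nil)
    (by cases a <;> decide +kernel)

theorem derivable_neighbours (a : Dir) : Derivable S1 (neighbours .vertical a) := by
  have h : Derivable S1 (neighbours .vertical .up) :=
    derivable_of_mem_S1 (M := Γ7) (by simp [S1])
  cases a
  exacts [h, h.neighbours_rotate.neighbours_turn]

/-- Two bands cross, the left one over the right one if `o` is rising, and under it otherwise. -/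
def bandCrossing (o : Slope) : List Letter :=
  [.crossing o 1, .crossing o 0, .crossing o 2, .crossing o 1]

/-- The two bands that end at two vertices pass through each other. -/
def bandPass (m : Marker) (a b : Dir) : LocalMove :=
  wordMove [a, a.flip, b, b.flip] (bandCrossing .rising ++ [.vertex m 0, .vertex m.turn 2])
    (bandCrossing .falling ++ [.vertex m 0, .vertex m.turn 2])

/-- The right band ends at the left vertex, because the bands cross below. A flype there exchanges
the two strands of the band, and triangle moves carry the crossing down through the band crossing to
the bottom. -/
theorem Derivable.bandPass_flip_right {m : Marker} {a b : Dir}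
    (h : Derivable S1 (bandPass m a b.flip)) : Derivable S1 (bandPass m a b) :=
  derivable_of_steps
    [.bwd 7 4 0, .fwd 5 5 0, .exch 6, .exch 1, .fwd 6 2 0, .fwd 6 0 1, .exch 2, .fwd 4 1 0, .exch
      2, .bwd 6 0 1, .bwd 6 2 0, .exch 1, .exch 6, .fwd 5 4 0, .fwd 7 5 0]
    (.cons (.single h) <| .cons (.overMarkers allDerivable_flypes) <|
      .cons allDerivable_triangles <|
      .cons (allDerivable_bigons .rising) <| .cons (allDerivable_bigons .falling) .nil)
    (by cases m <;> cases a <;> cases b <;> decide +kernel)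

/-- The same argument for the left band, which ends at the right vertex. -/
theorem Derivable.bandPass_flip_left {m : Marker} {a b : Dir}
    (h : Derivable S1 (bandPass m a.flip b)) : Derivable S1 (bandPass m a b) :=
  derivable_of_steps
    [.bwd 7 4 2, .exch 5, .fwd 5 6 2, .bwd 6 2 1, .bwd 6 0 0, .fwd 4 1 0, .fwd 6 0 0, .fwd 6 2 1,
    .exch 4, .fwd 5 5 2, .fwd 7 6 2]
    (.cons (.single h) <| .cons (.overMarkers allDerivable_flypes) <|
      .cons allDerivable_triangles <|
      .cons (allDerivable_bigons .rising) <| .cons (allDerivable_bigons .falling) .nil)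
    (by cases m <;> cases a <;> cases b <;> decide +kernel)

/-- Sliding the vertices down through the band crossing exchanges them. Four bigons create a falling
and a rising band crossing below; the given move changes the latter to falling. Sliding the vertices
down through it exchanges them back, and it cancels with the rising band crossing above. -/
theorem Derivable.bandPass_turn {m : Marker} {a b : Dir} (h : Derivable S1 (bandPass m b a)) :
    Derivable S1 (bandPass m.turn a b) :=
  derivable_of_steps
    [.exch 1, .fwd 5 2 0, .fwd 5 0 1, .exch 2, .fwd 6 3 1, .fwd 6 1 0, .exch 0, .bwd 8 0 1, .bwd 8
    1 2, .bwd 8 2 0, .bwd 8 3 1, .exch 1, .fwd 4 4 0, .exch 5, .fwd 5 6 0, .fwd 5 4 1, .exch 6,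
    .fwd 6 7 1, .fwd 6 5 0, .exch 7, .fwd 8 9 1, .fwd 8 8 0, .fwd 8 7 2, .fwd 8 6 1, .exch 4]
    (.cons (.single h) <| .cons allDerivable_passes <| .cons allDerivable_passesBack <|
      .cons (allDerivable_bigons .rising) <| .cons (allDerivable_bigons .falling) .nil)
    (by cases m <;> cases a <;> cases b <;> decide +kernel)

theorem derivable_bandPass (m : Marker) (a b : Dir) : Derivable S1 (bandPass m a b) := by
  have h : Derivable S1 (bandPass .vertical .up .up) :=
    derivable_of_mem_S1 (M := Γ8) (by simp [S1])
  have hv : ∀ a b, Derivable S1 (bandPass .vertical a b) := by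
    rintro (_ | _) (_ | _)
    exacts [h, h.bandPass_flip_right, h.bandPass_flip_left,
      (h.bandPass_flip_right (b := .down)).bandPass_flip_left]
  cases m
  exacts [(hv b a).bandPass_turn, hv a b]

/-! ### Orientations of unoriented moves -/

/-- The letter that denotes a slice with given underlying unoriented slice; `a` is the direction of
the left leg if the piece is a minimum. -/
def USlice.letter (a : Dir) (s : USlice) : Letter :=
  match s.piece with
  | .cup => .cup s.left a
  | .cap => .cap s.left
  | .crossing o => .crossing o s.left
  | .vertex m => .vertex m s.left

/-- The number of strands below a slice. -/
def USlice.width (s : USlice) : ℕ :=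
  s.left + (match s.piece with | .cup => 0 | _ => 2) + s.right

theorem Slice.length_bot (s : Slice) : s.bot.length = s.forget.width := by
  obtain ⟨l, p, r⟩ := s
  cases p <;> simp [Slice.bot, Slice.forget, USlice.width, Piece.dom, Piece.forget, Nat.add_comm 2,
    Nat.add_assoc]

theorem exists_letters (D : List Slice) : ∃ d : List Dir, d.length = (D.map Slice.forget).length ∧
    D.map Slice.letter = List.zipWith USlice.letter d (D.map Slice.forget) := by
  induction D with
  | nil => exact ⟨[], rfl, rfl⟩
  | cons s D ih =>
    obtain ⟨d, hd, h⟩ := ih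
    obtain ⟨a, ha⟩ : ∃ a, s.letter = s.forget.letter a := by
      obtain ⟨l, p, r⟩ := s
      cases p with
      | cup a => exact ⟨a, rfl⟩
      | _ => exact ⟨.up, rfl⟩
    exact ⟨a :: d, by simp [hd], by simp [h, ha]⟩

/-- An oriented move is determined by the underlying unoriented move, the directions of the strands
at the bottom, and the directions `d`, `e` of the minima. -/
theorem derivable_of_isOrientationOf {M : LocalMove} {s : USlice} {D E : List USlice}
    (h : IsOrientationOf M ⟨s :: D, E⟩)
    (H : ∀ u d e : List Dir, u.length = s.width → d.length = (s :: D).length →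
      e.length = E.length →
      (wordMove u (List.zipWith USlice.letter d (s :: D))
        (List.zipWith USlice.letter e E)).Valid →
      Derivable S (wordMove u (List.zipWith USlice.letter d (s :: D))
        (List.zipWith USlice.letter e E))) :
    Derivable S M := by
  obtain ⟨u, v, A, B⟩ := M
  obtain ⟨hv, hA, hB⟩ := h
  dsimp only at hA hB
  obtain ⟨d, hd, hd'⟩ := exists_letters A
  obtain ⟨e, he, he'⟩ := exists_letters B
  -- The left side is non-empty, so its first slice determines the number of strands at the bottom.
  have hu : u.length = s.width := by
    cases A with
    | nil => cases hA
    | cons t A =>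
      rw [← (List.cons.inj hA).1, ← t.length_bot, hv.1.1]
  have hM : (⟨u, v, A, B⟩ : LocalMove) = wordMove u (List.zipWith USlice.letter d (s :: D))
      (List.zipWith USlice.letter e E) := by
    rw [← hA, ← hB, ← hd', ← he', wordMove, hv.1.stack_eq, hv.2.stack_eq, ← hv.1.eq_finalWord]
  rw [hM] at hv ⊢
  exact H u d e hu (hA ▸ hd) (hB ▸ he) hv

theorem derivable_Ω1 {o : Slope} {M : LocalMove} (h : IsOrientationOf M
    ⟨[⟨1, .cup, 0⟩, ⟨0, .crossing o, 1⟩, ⟨1, .cap, 0⟩], []⟩) : Derivable S1 M :=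
  derivable_of_isOrientationOf h fun u d e hu hd he hv => by
    match u, d, e, hu, hd, he with
    | [a], [b, _, _], [], _, _, _ =>
      change (wordMove [a] [.cup 1 b, .crossing o 0, .cap 1] []).Valid at hv
      -- The maximum joins the given strand to the right leg of the minimum, so their directions
      -- must be opposite.
      obtain rfl : a = b := by
        cases a <;> cases b <;> first | rfl | exact absurd hv (by cases o <;> decide +kernel)
      exact derivable_kink o a

theorem derivable_Ω2 {M : LocalMove} (h : IsOrientationOf M Ω2) : Derivable S1 M :=
  derivable_of_isOrientationOf h fun u d e hu hd he _ => by
    match u, d, e, hu, hd, he with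
    | [a, b], [_, _], [], _, _, _ => exact derivable_bigon .rising a b

theorem derivable_Ω3 {x y z : Slope} (hxyz : x = z → y = x) {M : LocalMove}
    (h : IsOrientationOf M ⟨[⟨0, .crossing x, 1⟩, ⟨1, .crossing y, 0⟩, ⟨0, .crossing z, 1⟩],
      [⟨1, .crossing z, 0⟩, ⟨0, .crossing y, 1⟩, ⟨1, .crossing x, 0⟩]⟩) : Derivable S1 M :=
  derivable_of_isOrientationOf h fun u d e hu hd he _ => by
    match u, d, e, hu, hd, he with
    | [a, b, c], [_, _, _], [_, _, _], _, _, _ => exact derivable_triangle hxyz a b c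

theorem derivable_Ω4 {o : Slope} {m : Marker} {M : LocalMove} (h : IsOrientationOf M
    ⟨[⟨0, .crossing o, 1⟩, ⟨1, .crossing o, 0⟩, ⟨0, .vertex m, 1⟩],
      [⟨1, .vertex m, 0⟩, ⟨0, .crossing o, 1⟩, ⟨1, .crossing o, 0⟩]⟩) : Derivable S1 M :=
  derivable_of_isOrientationOf h fun u d e hu hd he hv => by
    match u, d, e, hu, hd, he with
    | [c, a, b], [_, _, _], [_, _, _], _, _, _ =>
      change (wordMove [c, a, b] [.crossing o 0, .crossing o 1, .vertex m 0]
        [.vertex m 1, .crossing o 0, .crossing o 1]).Valid at hv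
      obtain rfl : a.flip = b := by
        cases a <;> cases b <;>
          first | rfl | exact absurd hv (by cases o <;> cases m <;> cases c <;> decide +kernel)
      exact derivable_pass o m c a

theorem derivable_Ω5 {o : Slope} {m : Marker} {M : LocalMove} (h : IsOrientationOf M
    ⟨[⟨0, .crossing o, 0⟩, ⟨0, .vertex m, 0⟩], [⟨0, .vertex m, 0⟩, ⟨0, .crossing o, 0⟩]⟩) :
    Derivable S1 M :=
  derivable_of_isOrientationOf h fun u d e hu hd he hv => by
    match u, d, e, hu, hd, he with
    | [a, b], [_, _], [_, _], _, _, _ =>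
      change (wordMove [a, b] [.crossing o 0, .vertex m 0]
        [.vertex m 0, .crossing o 0]).Valid at hv
      obtain rfl : a.flip = b := by
        cases a <;> cases b <;>
          first | rfl | exact absurd hv (by cases o <;> cases m <;> decide +kernel)
      exact derivable_flype o m a

theorem derivable_Ω6 {m : Marker} {M : LocalMove} (h : IsOrientationOf M
    ⟨[⟨1, .cup, 0⟩, ⟨0, .vertex m, 1⟩, ⟨1, .cap, 0⟩], []⟩) : Derivable S1 M :=
  derivable_of_isOrientationOf h fun u d e hu hd he hv => by
    match u, d, e, hu, hd, he with
    | [a], [b, _, _], [], _, _, _ =>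
      change (wordMove [a] [.cup 1 b, .vertex m 0, .cap 1] []).Valid at hv
      obtain rfl : a.flip = b := by
        cases a <;> cases b <;> first | rfl | exact absurd hv (by cases m <;> decide +kernel)
      exact derivable_loop m a

theorem derivable_Ω7 {M : LocalMove} (h : IsOrientationOf M Ω7) : Derivable S1 M :=
  derivable_of_isOrientationOf h fun u d e hu hd he hv => by
    match u, d, e, hu, hd, he with
    | [a, b, c], [_, _], [_, _], _, _, _ =>
      change (wordMove [a, b, c] [.vertex .vertical 0, .vertex .horizontal 1]
        [.vertex .horizontal 1, .vertex .vertical 0]).Valid at hv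
      obtain ⟨rfl, rfl⟩ : a.flip = b ∧ a = c := by
        cases a <;> cases b <;> cases c <;>
          first | exact ⟨rfl, rfl⟩ | exact absurd hv (by decide +kernel)
      exact derivable_neighbours a

theorem derivable_Ω8 {m : Marker} {M : LocalMove} (h : IsOrientationOf M
    ⟨[⟨1, .crossing .rising, 1⟩, ⟨0, .crossing .rising, 2⟩, ⟨2, .crossing .rising, 0⟩,
        ⟨1, .crossing .rising, 1⟩, ⟨0, .vertex m, 2⟩, ⟨2, .vertex m.turn, 0⟩],
      [⟨1, .crossing .falling, 1⟩, ⟨0, .crossing .falling, 2⟩, ⟨2, .crossing .falling, 0⟩,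
        ⟨1, .crossing .falling, 1⟩, ⟨0, .vertex m, 2⟩, ⟨2, .vertex m.turn, 0⟩]⟩) :
    Derivable S1 M :=
  derivable_of_isOrientationOf h fun u d e hu hd he hv => by
    match u, d, e, hu, hd, he with
    | [a, a', b, b'], [_, _, _, _, _, _], [_, _, _, _, _, _], _, _, _ =>
      change (wordMove [a, a', b, b']
        (bandCrossing .rising ++ [.vertex m 0, .vertex m.turn 2])
        (bandCrossing .falling ++ [.vertex m 0, .vertex m.turn 2])).Valid at hv
      obtain ⟨rfl, rfl⟩ : a.flip = a' ∧ b.flip = b' := by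
        cases a <;> cases a' <;> cases b <;> cases b' <;>
          first | exact ⟨rfl, rfl⟩ | exact absurd hv (by cases m <;> decide +kernel)
      exact derivable_bandPass m a b

theorem derivable_of_mem_orientedYoshikawaMoves {M : LocalMove}
    (hM : M ∈ orientedYoshikawaMoves) : Derivable S1 M := by
  obtain ⟨N, hN, h⟩ := hM
  simp only [unorientedYoshikawaMoves, Set.mem_insert_iff, Set.mem_singleton_iff] at hN
  rcases hN with rfl | rfl | rfl | rfl | rfl | rfl | rfl | rfl | rfl | rfl | rfl | rfl | rfl | rfl |
    rfl | rfl | rfl | rfl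
  exacts [derivable_Ω1 h, derivable_Ω1 h, derivable_Ω2 h, derivable_Ω3 (by decide) h,
    derivable_Ω3 (by decide) h, derivable_Ω4 h, derivable_Ω4 h, derivable_Ω4 h, derivable_Ω4 h,
    derivable_Ω5 h, derivable_Ω5 h, derivable_Ω5 h, derivable_Ω5 h, derivable_Ω6 h,
    derivable_Ω6 h, derivable_Ω7 h, derivable_Ω8 (m := .vertical) h,
    derivable_Ω8 (m := .horizontal) h]

/-! ### The eleven moves are oriented Yoshikawa moves, and `Γ3` is cyclic -/

instance (M : LocalMove) (N : UMove) : Decidable (IsOrientationOf M N) :=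
  inferInstanceAs (Decidable (M.Valid ∧ _ ∧ _))

theorem S1_subset_orientedYoshikawaMoves : S1 ⊆ orientedYoshikawaMoves := by
  have h : ∀ {M : LocalMove} (N : UMove), N ∈ unorientedYoshikawaMoves → IsOrientationOf M N →
      M ∈ orientedYoshikawaMoves := fun N hN hM => ⟨N, hN, hM⟩
  intro M hM
  simp only [S1, Set.mem_insert_iff, Set.mem_singleton_iff] at hM
  rcases hM with rfl | rfl | rfl | rfl | rfl | rfl | rfl | rfl | rfl | rfl | rfl
  exacts [h Ω1 (by simp [unorientedYoshikawaMoves]) (by decide +kernel),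
    h Ω1 (by simp [unorientedYoshikawaMoves]) (by decide +kernel),
    h Ω2 (by simp [unorientedYoshikawaMoves]) (by decide +kernel),
    h Ω3 (by simp [unorientedYoshikawaMoves]) (by decide +kernel),
    h Ω4 (by simp [unorientedYoshikawaMoves]) (by decide +kernel),
    h Ω4' (by simp [unorientedYoshikawaMoves]) (by decide +kernel),
    h Ω5 (by simp [unorientedYoshikawaMoves]) (by decide +kernel),
    h Ω6 (by simp [unorientedYoshikawaMoves]) (by decide +kernel),
    h Ω6' (by simp [unorientedYoshikawaMoves]) (by decide +kernel),
    h Ω7 (by simp [unorientedYoshikawaMoves]) (by decide +kernel),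
    h Ω8 (by simp [unorientedYoshikawaMoves]) (by decide +kernel)]

theorem isCyclicΩ3_Γ3 : IsCyclicΩ3 Γ3 := by
  -- On both sides of the move the sides 01, 02, 12 of the triangle start at the corners 1, 0, 2.
  have h : CyclicTriangle .down .up .down := by unfold CyclicTriangle; decide +kernel
  exact ⟨by decide +kernel,
    ⟨_, _, _, .down, .up, .down, .down, .down, rfl, rfl, rfl, h⟩,
    ⟨_, _, _, .down, .up, .down, .down, .down, rfl, rfl, rfl, h⟩⟩

end Yoshikawa

theorem theorem1p3 :
    Yoshikawa.IsGeneratingSet Yoshikawa.S1 ∧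
      Yoshikawa.Γ3 ∈ Yoshikawa.S1 ∧ Yoshikawa.IsCyclicΩ3 Yoshikawa.Γ3 :=
  ⟨⟨Yoshikawa.S1_subset_orientedYoshikawaMoves, fun _ hM =>
      (Yoshikawa.derivable_of_mem_orientedYoshikawaMoves hM).2⟩,
    by simp [Yoshikawa.S1], Yoshikawa.isCyclicΩ3_Γ3⟩
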